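/- Let $M$ be a connected smooth manifold (Hausdorff, second countable, without boundary) of positive finite dimension with $H^1(M;\mathbb R)=0$, and let $\lambda$ be a smooth one-form on $M$ such that $d\lambda$ is symplectic. Let $\mathrm{Symp}(M,d\lambda)$ be the group of diffeomorphisms $f$ of $M$ with $f^*d\lambda=d\lambda$. Fix a point $x\in M$ and let $$\mathfrak G=\mathfrak G_{x,\lambda}\colon \mathrm{Symp}(M,d\lambda)\times\mathrm{Symp}(M,d\lambda)\to\mathbb R,\qquad \mathfrak G(g,h)=\int_x^{h(x)} (g^*\lambda-\lambda),$$ where the closed one-form $g^*\lambda-\lambda$ is integrated along any smooth path from $x$ to $h(x)$ (the value does not depend on the path). Then: 1. The two-cocycle $\mathfrak G$ is unbounded on $\mathrm{Symp}(M,d\lambda)$: for every $C\in\mathbb R$ there are $g,h\in\mathrm{Symp}(M,d\lambda)$ with $|\mathfrak G(g,h)|>C$. 2. Suppose moreover that $p\colon(M,d\lambda)\to(X,\sigma)$ is the universal cover of a closed symplectic manifold $(X,\sigma)$, with $p^*\sigma=d\lambda$. Regard the group $\mathrm{Ham}(X,\sigma)$ of Hamiltonian diffeomorphisms (time-one maps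 of Hamiltonian isotopies starting at the identity) as a subgroup of $\mathrm{Symp}(M,d\lambda)$ by sending $f$ to the endpoint $\tilde f=\tilde f_1$ of the lift $(\tilde f_t)$, $\tilde f_0=\mathrm{id}_M$, of a Hamiltonian isotopy $(f_t)$ from $\mathrm{id}_X$ to $f$. Then the restriction of $\mathfrak G$ to $\mathrm{Ham}(X,\sigma)$ is unbounded: for every $C\in\mathbb R$ there are $g,h\in\mathrm{Ham}(X,\sigma)$ with $|\mathfrak G(\tilde g,\tilde h)|>C$. -/

import Mathlib

open scoped Manifold ContDiff

noncomputable section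

namespace SympCocycle

/-! Smooth manifolds without boundary are modelled on a finite-dimensional real normed space `E`
through `𝓘(ℝ, E)`. -/

/-- A (not necessarily smooth) differential `k`-form on `M`. -/
abbrev Form (E : Type*) [NormedAddCommGroup E] [NormedSpace ℝ E] (M : Type*)
    [TopologicalSpace M] [ChartedSpace E M] (k : ℕ) : Type _ :=
  (x : M) → TangentSpace 𝓘(ℝ, E) x [⋀^Fin k]→L[ℝ] ℝ

/-- The pullback `f^* η` of a form along a map `f : M → N` (meant for smooth `f`). -/
def pullback {E : Type*} [NormedAddCommGroup E] [NormedSpace ℝ E]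
    {M : Type*} [TopologicalSpace M] [ChartedSpace E M]
    {E' : Type*} [NormedAddCommGroup E'] [NormedSpace ℝ E']
    {N : Type*} [TopologicalSpace N] [ChartedSpace E' N] {k : ℕ}
    (f : M → N) (η : Form E' N k) : Form E M k :=
  fun x => (η (f x)).compContinuousLinearMap (mfderiv 𝓘(ℝ, E) 𝓘(ℝ, E') f x)

section Forms

variable {E : Type*} [NormedAddCommGroup E] [NormedSpace ℝ E]
  {M : Type*} [TopologicalSpace M] [ChartedSpace E M] {k : ℕ}

/-- The coordinate expression of `η` in the preferred chart at `c`, a form on the vector space `E`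
(meaningful on the target of that chart): the pullback of `η` along the inverse chart. -/
def chartForm (η : Form E M k) (c : M) : E → E [⋀^Fin k]→L[ℝ] ℝ :=
  fun y => (η ((extChartAt 𝓘(ℝ, E) c).symm y)).compContinuousLinearMap
    (mfderiv 𝓘(ℝ, E) 𝓘(ℝ, E) (extChartAt 𝓘(ℝ, E) c).symm y)

/-- A form is smooth if all its coordinate expressions are. -/
def IsSmooth (η : Form E M k) : Prop :=
  ∀ c : M, ContDiffOn ℝ ∞ (chartForm η c) (extChartAt 𝓘(ℝ, E) c).target

/-- The exterior derivative `dη`, computed at `x` in the preferred chart at `x`. -/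
def extD (η : Form E M k) : Form E M (k + 1) :=
  fun x => (extDeriv (chartForm η x) (extChartAt 𝓘(ℝ, E) x x)).compContinuousLinearMap
    (mfderiv 𝓘(ℝ, E) 𝓘(ℝ, E) (extChartAt 𝓘(ℝ, E) x) x)

/-- A symplectic form: a smooth, closed, nondegenerate two-form. -/
structure IsSymplectic (η : Form E M 2) : Prop where
  smooth : IsSmooth η
  closed : extD η = 0
  nondegenerate : ∀ (x : M) (v : TangentSpace 𝓘(ℝ, E) x),
    (∀ w : TangentSpace 𝓘(ℝ, E) x, η x ![v, w] = 0) → v = 0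

variable (E M) in
/-- `H¹(M; ℝ) = 0`, in de Rham form: every smooth closed one-form is the differential of a smooth
function. -/
def FirstCohomologyVanishes : Prop :=
  ∀ α : Form E M 1, IsSmooth α → extD α = 0 →
    ∃ f : M → ℝ, ContMDiff 𝓘(ℝ, E) 𝓘(ℝ, ℝ) ∞ f ∧
      ∀ (x : M) (v : TangentSpace 𝓘(ℝ, E) x), α x ![v] = mfderiv 𝓘(ℝ, E) 𝓘(ℝ, ℝ) f x v

/-- `γ` is a smooth path from `x = γ 0` to `y = γ 1`; only its restriction to `[0, 1]` matters. -/
def IsSmoothPath (E : Type*) [NormedAddCommGroup E] [NormedSpace ℝ E]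
    {M : Type*} [TopologicalSpace M] [ChartedSpace E M] (γ : ℝ → M) (x y : M) : Prop :=
  ContMDiff 𝓘(ℝ, ℝ) 𝓘(ℝ, E) ∞ γ ∧ γ 0 = x ∧ γ 1 = y

/-- The integral of the one-form `α` along the path `γ : [0, 1] → M`. -/
def pathIntegral (α : Form E M 1) (γ : ℝ → M) : ℝ :=
  ∫ t in (0 : ℝ)..1, α (γ t) ![mfderiv 𝓘(ℝ, ℝ) 𝓘(ℝ, E) γ t (1 : ℝ)]

open Classical in
/-- `∫_x^y α`: the integral of `α` along a smooth path from `x` to `y`. If `M` is connected such a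
path exists, and if `H¹(M; ℝ) = 0` and `α` is closed the value does not depend on it. -/
def integralBetween (α : Form E M 1) (x y : M) : ℝ :=
  if h : ∃ γ : ℝ → M, IsSmoothPath E γ x y then pathIntegral α h.choose else 0

/-- The symplectic diffeomorphisms of `(M, η)`. -/
abbrev Symp (η : Form E M 2) : Type _ :=
  {f : M ≃ₘ⟮𝓘(ℝ, E), 𝓘(ℝ, E)⟯ M // pullback f η = η}

/-- The Ismagilov–Losik–Michor two-cocycle
`𝔊_{x,λ}(g, h) = ∫_x^{h(x)} (g^* λ - λ)` on `Symp(M, dλ)`. -/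
def cocycle (lam : Form E M 1) (x : M) (g h : Symp (extD lam)) : ℝ :=
  integralBetween (pullback g.1 lam - lam) x (h.1 x)

end Forms

/-- The function `c` of two arguments is unbounded on `S`. -/
def UnboundedOn {G : Type*} (c : G → G → ℝ) (S : Set G) : Prop :=
  ∀ C : ℝ, ∃ g ∈ S, ∃ h ∈ S, C < |c g h|

section Covers

variable {E : Type*} [NormedAddCommGroup E] [NormedSpace ℝ E]
  {M : Type*} [TopologicalSpace M] [ChartedSpace E M]
  {X : Type*} [TopologicalSpace X] [ChartedSpace E X]

/-- `p` makes `(M, η)` the universal cover of the symplectic manifold `(X, σ)`. -/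
structure IsUniversalCover (η : Form E M 2) (σ : Form E X 2) (p : M → X) : Prop where
  simplyConnected : SimplyConnectedSpace M
  covering : IsCoveringMap p
  surjective : Function.Surjective p
  localDiffeo : IsLocalDiffeomorph 𝓘(ℝ, E) 𝓘(ℝ, E) ∞ p
  pullback_eq : pullback p σ = η

/-- A smooth isotopy of `M` starting at the identity. -/
structure IsIsotopy (F : ℝ → (M ≃ₘ⟮𝓘(ℝ, E), 𝓘(ℝ, E)⟯ M)) : Prop where
  smooth : ContMDiff (𝓘(ℝ, ℝ).prod 𝓘(ℝ, E)) 𝓘(ℝ, E) ∞ (fun z : ℝ × M => F z.1 z.2)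
  start : ∀ x : M, F 0 x = x

/-- `F` is the Hamiltonian isotopy of `(X, σ)` generated by the smooth time-dependent Hamiltonian
`H`: `d/dt F_t = Y_t ∘ F_t` with `σ(Y_t, ·) = dH_t`. The opposite sign convention amounts to
replacing `H` by `-H`. Time runs over `ℝ`; after a smooth reparametrisation, every Hamiltonian
isotopy over `[0, 1]` extends to `ℝ` with the same time-one map. -/
structure IsHamiltonianIsotopy (σ : Form E X 2) (H : ℝ → X → ℝ)
    (F : ℝ → (X ≃ₘ⟮𝓘(ℝ, E), 𝓘(ℝ, E)⟯ X)) : Prop extends IsIsotopy F where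
  smooth_hamiltonian :
    ContMDiff (𝓘(ℝ, ℝ).prod 𝓘(ℝ, E)) 𝓘(ℝ, ℝ) ∞ (fun z : ℝ × X => H z.1 z.2)
  equation : ∀ (t : ℝ) (q : X) (w : TangentSpace 𝓘(ℝ, E) (F t q)),
    σ (F t q) ![mfderiv 𝓘(ℝ, ℝ) 𝓘(ℝ, E) (fun s : ℝ => F s q) t (1 : ℝ), w] =
      mfderiv 𝓘(ℝ, E) 𝓘(ℝ, ℝ) (H t) (F t q) w

/-- The Hamiltonian diffeomorphisms of `(X, σ)`: time-one maps of Hamiltonian isotopies. -/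
def Ham (σ : Form E X 2) : Set (X ≃ₘ⟮𝓘(ℝ, E), 𝓘(ℝ, E)⟯ X) :=
  {f | ∃ H F, IsHamiltonianIsotopy σ H F ∧ F 1 = f}

/-- `ft` is the lift to `M` of the Hamiltonian diffeomorphism `f` of `(X, σ)`: it is the endpoint
of an isotopy of `M` from the identity that covers a Hamiltonian isotopy from the identity
to `f`. -/
def IsHamLift (σ : Form E X 2) (p : M → X) (f : X ≃ₘ⟮𝓘(ℝ, E), 𝓘(ℝ, E)⟯ X)
    (ft : M ≃ₘ⟮𝓘(ℝ, E), 𝓘(ℝ, E)⟯ M) : Prop :=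
  ∃ (H : ℝ → X → ℝ) (F : ℝ → (X ≃ₘ⟮𝓘(ℝ, E), 𝓘(ℝ, E)⟯ X))
    (Ft : ℝ → (M ≃ₘ⟮𝓘(ℝ, E), 𝓘(ℝ, E)⟯ M)),
    IsHamiltonianIsotopy σ H F ∧ F 1 = f ∧
      IsIsotopy Ft ∧ (∀ (t : ℝ) (y : M), p (Ft t y) = F t (p y)) ∧ Ft 1 = ft

/-- `Ham(X, σ)` viewed inside `Symp(M, η)`, for `p : (M, η) → (X, σ)` the universal cover: the
image of `f ↦ (lift of f)`. -/
def hamInSymp (η : Form E M 2) (σ : Form E X 2) (p : M → X) : Set (Symp η) :=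
  {g | ∃ f ∈ Ham σ, IsHamLift σ p f g.1}

end Covers

end SympCocycle

end

/-! Let `H` be a Hamiltonian on `(M, dλ)` with flow `Ψ` and generating field `Y`, so that `dλ(Y, ·)
= dH`. Cartan's formula gives `d/ds Ψ_s^*λ = Ψ_s^* d(H + λ(Y))`. If `Ψ` fixes both ends of a path
from `x` to `y`, then `Y` vanishes there and `H` is constant along the two stationary orbits.
Integrating over the path and over `0 ≤ s ≤ 1` gives `∫_x^y (Ψ_1^*λ - λ) = H(y) - H(x)`, whatever
the path (`pathIntegral_pullback_flow_sub`). The cocycle is thus large as soon as `h` moves `x` and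
`g` is generated by a Hamiltonian that is locally constant near `x` and near `h(x)`, with very
different values there.

For the covering statement both Hamiltonians are built on `X`. One is linear near `p x`, so its flow
carries `p x` to some other point `q'` (`exists_hamiltonian_flow_moving`). The other is a tall bump,
constant near `p x` and zero near `q'` (`exists_hamiltonian_flow_fixing`). Flows lift through a
smooth covering, lifts solve Hamilton's equation for `H ∘ p`, and points over stationary points stay
fixed (`IsFlow.exists_lift`, `SolvesHamilton.lift`). This gives `unboundedOn_hamInSymp` for any
smooth covering with `p^*σ = dλ`; the statement about the whole symplectic group is its case `p =
id`.

Each Hamiltonian is supported in one chart, so the flows reduce to compactly supported vector fields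
on the model space. Joint smoothness of such a flow in time and space comes from the implicit
function theorem in the Banach space `C([0,1], E)` (`exists_contDiff_flow`). That flows are
symplectic is `pullback_flow_eq`. -/

noncomputable section

namespace SympCocycle

section Flow

open Set Filter Topology

universe u

/-! ### Smoothness of composition operators on spaces of continuous maps. -/

section Nemytskii

variable {K : Type*} [TopologicalSpace K] [CompactSpace K]
  {E : Type u} [NormedAddCommGroup E] [NormedSpace ℝ E]
  {F : Type u} [NormedAddCommGroup F] [NormedSpace ℝ F]

variable (K E F) in
/-- Pointwise application of operator-valued functions, as a continuous bilinear map. -/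
def pointwiseApply : C(K, E →L[ℝ] F) →L[ℝ] C(K, E) →L[ℝ] C(K, F) :=
  LinearMap.mkContinuous₂
    (LinearMap.mk₂ ℝ (fun (A : C(K, E →L[ℝ] F)) (h : C(K, E)) =>
        (⟨fun t => A t (h t), A.continuous.clm_apply h.continuous⟩ : C(K, F)))
      (fun _ _ _ => by ext; simp) (fun _ _ _ => by ext; simp)
      (fun _ _ _ => by ext; simp) (fun _ _ _ => by ext; simp)) 1
    (fun A h => by
      rw [one_mul]
      refine (ContinuousMap.norm_le _ (by positivity)).2 fun t => ?_
      exact (A t).le_of_opNorm_le_of_le (A.norm_coe_le_norm t) (h.norm_coe_le_norm t))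

@[simp]
theorem pointwiseApply_apply (A : C(K, E →L[ℝ] F)) (h : C(K, E)) (t : K) :
    pointwiseApply K E F A h t = A t (h t) := rfl

theorem norm_pointwiseApply_le (A : C(K, E →L[ℝ] F)) : ‖pointwiseApply K E F A‖ ≤ ‖A‖ := by
  refine ContinuousLinearMap.opNorm_le_bound _ (norm_nonneg A) fun h => ?_
  refine (ContinuousMap.norm_le _ (by positivity)).2 fun t => ?_
  exact (A t).le_of_opNorm_le_of_le (A.norm_coe_le_norm t) (h.norm_coe_le_norm t)

/-- The derivative is globally Lipschitz by compact support, so the mean value inequality bounds the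
Taylor remainder quadratically. Uniformity in `y` is what carries the estimate over to the sup norm
on `C(K, E)`. -/
theorem exists_norm_sub_sub_fderiv_le {V : E → F} (hV : ContDiff ℝ ∞ V)
    (hc : HasCompactSupport V) :
    ∃ C : ℝ, 0 ≤ C ∧ ∀ y k : E, ‖V (y + k) - V y - fderiv ℝ V y k‖ ≤ C * ‖k‖ * ‖k‖ := by
  obtain ⟨C, hC⟩ := ContDiff.lipschitzWith_of_hasCompactSupport (hc.fderiv ℝ)
    (hV.fderiv_right (m := 1) (by norm_cast)) (by norm_num)
  refine ⟨C, C.2, fun y k => ?_⟩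
  have := Convex.norm_image_sub_le_of_norm_hasFDerivWithin_le' (𝕜 := ℝ) (f := V)
    (f' := fderiv ℝ V) (φ := fderiv ℝ V y) (C := C * ‖k‖) (s := Metric.closedBall y ‖k‖)
    (x := y) (y := y + k)
    (fun z _ => ((hV.differentiable (by simp)) z).hasFDerivAt.hasFDerivWithinAt)
    (fun z hz => by
      rw [← dist_eq_norm]
      refine (hC.dist_le_mul z y).trans ?_
      gcongr
      exact hz)
    (convex_closedBall _ _) (by simp) (by simp [Metric.mem_closedBall])
  simpa using this

theorem hasFDerivAt_continuousMap_comp (V : C(E, F)) (hV : ContDiff ℝ ∞ V)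
    (hc : HasCompactSupport V) (V' : C(E, E →L[ℝ] F)) (hV' : ∀ y, V' y = fderiv ℝ V y)
    (u : C(K, E)) :
    HasFDerivAt (fun u : C(K, E) => V.comp u) (pointwiseApply K E F (V'.comp u)) u := by
  obtain ⟨C, hC0, hC⟩ := exists_norm_sub_sub_fderiv_le hV hc
  rw [hasFDerivAt_iff_isLittleO_nhds_zero]
  have h1 : (fun h : C(K, E) => V.comp (u + h) - V.comp u - pointwiseApply K E F (V'.comp u) h)
      =O[𝓝 0] fun h : C(K, E) => ‖h‖ ^ 2 := by
    refine Asymptotics.IsBigO.of_bound C (Eventually.of_forall fun h => ?_)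
    refine (ContinuousMap.norm_le _ (by positivity)).2 fun t => ?_
    have := hC (u t) (h t)
    simp only [ContinuousMap.sub_apply, ContinuousMap.comp_apply, ContinuousMap.add_apply,
      pointwiseApply_apply, hV']
    refine this.trans ?_
    rw [mul_assoc, ← sq, norm_pow, norm_norm]
    gcongr
    exact h.norm_coe_le_norm t
  refine h1.trans_isLittleO ?_
  simpa using Asymptotics.isLittleO_norm_pow_id (E' := C(K, E)) one_lt_two

/-- The derivative of `u ↦ V ∘ u` is `u ↦ V' ∘ u` followed by a continuous linear map, so regularity
is gained by induction. The target changes from `F` to `E →L[ℝ] F` at each step; hence the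
quantification over `F` and the common universe. -/
theorem contDiff_nat_continuousMap_comp (n : ℕ) :
    ∀ {F : Type u} [NormedAddCommGroup F] [NormedSpace ℝ F] (V : C(E, F)), ContDiff ℝ ∞ V →
      HasCompactSupport V → ContDiff ℝ n (fun u : C(K, E) => V.comp u) := by
  induction n with
  | zero =>
    intro F _ _ V hV hc
    have hV' : Continuous (fderiv ℝ V) := hV.continuous_fderiv (by simp)
    refine contDiff_zero.2 (continuous_iff_continuousAt.2 fun u => ?_)
    exact (hasFDerivAt_continuousMap_comp V hV hc ⟨_, hV'⟩ (fun _ => rfl) u).continuousAt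
  | succ n ih =>
    intro F _ _ V hV hc
    have hV' : Continuous (fderiv ℝ V) := hV.continuous_fderiv (by simp)
    have hd := fun u : C(K, E) => hasFDerivAt_continuousMap_comp V hV hc ⟨_, hV'⟩ (fun _ => rfl) u
    have hfd : fderiv ℝ (fun u : C(K, E) => V.comp u) =
        fun u => pointwiseApply K E F (ContinuousMap.comp ⟨_, hV'⟩ u) :=
      funext fun u => (hd u).fderiv
    push_cast
    refine contDiff_succ_iff_fderiv.2 ⟨fun u => (hd u).differentiableAt, by simp, ?_⟩
    rw [hfd]
    exact (pointwiseApply K E F).contDiff.comp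
      (ih ⟨_, hV'⟩ (hV.fderiv_right (m := ∞) (by simp)) (hc.fderiv ℝ))

/-- Composition with a smooth compactly supported map is a smooth operator on `C(K, E)`. -/
theorem contDiff_continuousMap_comp (V : C(E, F)) (hV : ContDiff ℝ ∞ V)
    (hc : HasCompactSupport V) : ContDiff ℝ ∞ (fun u : C(K, E) => V.comp u) :=
  contDiff_infty.2 fun n => contDiff_nat_continuousMap_comp n V hV hc

end Nemytskii

/-! ### The integration operator on paths. -/

section Volterra

open unitInterval

variable {E : Type u} [NormedAddCommGroup E] [NormedSpace ℝ E]

omit [NormedSpace ℝ E] in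
theorem continuous_iccExtend (u : C(I, E)) : Continuous (IccExtend zero_le_one u) :=
  u.continuous.Icc_extend'

variable (E) in
/-- The operator sending `u` to its primitive `t ↦ ∫₀ᵗ u`. -/
def primitive : C(I, E) →L[ℝ] C(I, E) :=
  LinearMap.mkContinuous
    { toFun := fun u => ⟨fun t => ∫ r in (0 : ℝ)..t, IccExtend zero_le_one u r,
        (intervalIntegral.continuous_primitive
          (fun a b => (continuous_iccExtend u).intervalIntegrable a b) 0).comp
            continuous_subtype_val⟩
      map_add' := fun u v => by
        ext t
        simp only [ContinuousMap.coe_mk, ContinuousMap.add_apply]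
        rw [← intervalIntegral.integral_add ((continuous_iccExtend u).intervalIntegrable _ _)
          ((continuous_iccExtend v).intervalIntegrable _ _)]
        rfl
      map_smul' := fun c u => by
        ext t
        simp only [ContinuousMap.coe_mk, ContinuousMap.smul_apply, RingHom.id_apply]
        rw [← intervalIntegral.integral_smul]
        rfl } 1
    (fun u => by
      refine (ContinuousMap.norm_le _ (by positivity)).2 fun t => ?_
      have := intervalIntegral.norm_integral_le_of_norm_le_const (a := 0) (b := (t : ℝ)) (C := ‖u‖)
        (f := IccExtend zero_le_one u) (fun r _ => u.norm_coe_le_norm _)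
      refine this.trans ?_
      rw [sub_zero, abs_of_nonneg t.2.1, one_mul]
      exact mul_le_of_le_one_right (norm_nonneg _) t.2.2)

theorem primitive_apply (u : C(I, E)) (t : I) :
    primitive E u t = ∫ r in (0 : ℝ)..t, IccExtend zero_le_one u r := rfl

theorem norm_primitive_le : ‖primitive E‖ ≤ 1 :=
  LinearMap.mkContinuous_norm_le _ zero_le_one _

end Volterra

end Flow

/-! ### Short-time smoothness of flows by the implicit function theorem. -/

section Flow

open Set Filter Topology unitInterval

universe u

variable {E : Type u} [NormedAddCommGroup E] [NormedSpace ℝ E]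

variable (E) in
/-- The constant functions, as a continuous linear map. -/
def constPath : E →L[ℝ] C(I, E) :=
  LinearMap.mkContinuous
    { toFun := fun x => ContinuousMap.const I x
      map_add' := fun _ _ => rfl
      map_smul' := fun _ _ => rfl } 1
    (fun x => by
      rw [one_mul]
      exact (ContinuousMap.norm_le _ (norm_nonneg x)).2 fun _ => le_rfl)

@[simp]
theorem constPath_apply (x : E) (t : I) : constPath E x t = x := rfl

variable (E) in
/-- Evaluation of a path at its endpoint. -/
def evalOne : C(I, E) →L[ℝ] E :=
  LinearMap.mkContinuous
    { toFun := fun u => u 1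
      map_add' := fun _ _ => rfl
      map_smul' := fun _ _ => rfl } 1
    (fun u => by
      rw [one_mul]
      exact u.norm_coe_le_norm 1)

/-- The defect of a path `u` as a solution of `u' = τ V(u)`, `u 0 = x`, in integral form. -/
def odeDefect (V : C(E, E)) (z : (ℝ × E) × C(I, E)) : C(I, E) :=
  z.2 - constPath E z.1.2 - z.1.1 • primitive E (V.comp z.2)

theorem contDiff_odeDefect (V : C(E, E)) (hV : ContDiff ℝ ∞ V) (hc : HasCompactSupport V) :
    ContDiff ℝ ∞ (odeDefect V) := by
  have h1 : ContDiff ℝ ∞ fun z : (ℝ × E) × C(I, E) => primitive E (V.comp z.2) :=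
    (primitive E).contDiff.comp ((contDiff_continuousMap_comp V hV hc).comp contDiff_snd)
  have h2 : ContDiff ℝ ∞ fun z : (ℝ × E) × C(I, E) => constPath E z.1.2 :=
    (constPath E).contDiff.comp (contDiff_snd.comp contDiff_fst)
  exact (contDiff_snd.sub h2).sub ((contDiff_fst.comp contDiff_fst).smul h1)

/-- A trajectory, run at speed `τ` over the unit interval. -/
def trajectory (γ : ℝ → E → E) (hγ : ∀ x, Continuous fun t => γ t x) (τ : ℝ) (x : E) : C(I, E) :=
  ⟨fun r => γ (τ * r) x, (hγ x).comp (by fun_prop)⟩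

/-- Rescaling time puts all trajectories on `[0, 1]` and turns time into the parameter `τ`, so that
the implicit function theorem yields smoothness in `(τ, x)` jointly. -/
theorem odeDefect_trajectory [CompleteSpace E] (V : C(E, E)) {γ : ℝ → E → E}
    (hγ : ∀ x, Continuous fun t => γ t x)
    (h0 : ∀ x, γ 0 x = x) (hd : ∀ x t, HasDerivAt (fun t => γ t x) (V (γ t x)) t)
    (τ : ℝ) (x : E) : odeDefect V ((τ, x), trajectory γ hγ τ x) = 0 := by
  ext t
  have hder : ∀ r : ℝ, HasDerivAt (fun r => γ (τ * r) x) (τ • V (γ (τ * r) x)) r := fun r => by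
    have := (hd x (τ * r)).scomp r ((hasDerivAt_id r).const_mul τ)
    simpa [Function.comp_def] using this
  have hcont : Continuous fun r : ℝ => V (γ (τ * r) x) :=
    V.continuous.comp ((hγ x).comp (by fun_prop))
  have hint := intervalIntegral.integral_eq_sub_of_hasDerivAt (a := 0) (b := (t : ℝ))
    (fun r _ => hder r) ((continuous_const.smul hcont).intervalIntegrable _ _)
  rw [intervalIntegral.integral_smul] at hint
  have hcongr : ∫ r in (0 : ℝ)..t, IccExtend zero_le_one (V.comp (trajectory γ hγ τ x)) r =
      ∫ r in (0 : ℝ)..t, V (γ (τ * r) x) := by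
    refine intervalIntegral.integral_congr fun r hr => ?_
    rw [uIcc_of_le t.2.1] at hr
    have hr' : r ∈ Icc (0 : ℝ) 1 := ⟨hr.1, hr.2.trans t.2.2⟩
    simp [IccExtend, projIcc_of_mem zero_le_one hr', trajectory]
  simp only [odeDefect, ContinuousMap.sub_apply, constPath_apply, ContinuousMap.smul_apply,
    primitive_apply, hcongr, hint]
  simp [trajectory, h0]

theorem norm_fderiv_le_of_lipschitz_comp (V : C(E, E)) (hV : ContDiff ℝ ∞ V)
    (hc : HasCompactSupport V) {C : NNReal} (hC : LipschitzWith C V) (u : C(I, E)) :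
    ∃ D : C(I, E) →L[ℝ] C(I, E), ‖D‖ ≤ C ∧ HasFDerivAt (fun u : C(I, E) => V.comp u) D u := by
  have hV' : Continuous (fderiv ℝ V) := hV.continuous_fderiv (by simp)
  refine ⟨_, ?_, hasFDerivAt_continuousMap_comp V hV hc ⟨_, hV'⟩ (fun _ => rfl) u⟩
  refine (norm_pointwiseApply_le _).trans ((ContinuousMap.norm_le _ C.2).2 fun t => ?_)
  exact norm_fderiv_le_of_lipschitz ℝ hC

theorem isInvertible_one_sub_smul_comp {B : Type*} [NormedAddCommGroup B] [NormedSpace ℝ B]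
    [CompleteSpace B] {P D : B →L[ℝ] B} {τ C : ℝ} (hP : ‖P‖ ≤ 1) (hD : ‖D‖ ≤ C)
    (hτ : |τ| * C < 1) : (1 - τ • (P ∘L D)).IsInvertible := by
  suffices h : ‖τ • (P ∘L D)‖ < 1 by
    obtain ⟨w, hw⟩ := isUnit_one_sub_of_norm_lt_one h
    exact ⟨ContinuousLinearEquiv.unitsEquiv ℝ _ w, hw⟩
  refine lt_of_le_of_lt ?_ hτ
  rw [norm_smul, Real.norm_eq_abs]
  gcongr
  refine (P.opNorm_comp_le D).trans ?_
  calc ‖P‖ * ‖D‖ ≤ 1 * C := by gcongr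
    _ = C := one_mul _

/-- The partial derivative in the path variable is `1 - τ P D`, with `P` integration and `‖D‖ ≤ C`;
for `|τ| C < 1` the Neumann series inverts it. -/
theorem fderiv_odeDefect_isInvertible [CompleteSpace E] (V : C(E, E)) (hV : ContDiff ℝ ∞ V)
    (hc : HasCompactSupport V) {C : NNReal} (hC : LipschitzWith C V) {τ : ℝ} (hτ : |τ| * C < 1)
    (x : E) (u : C(I, E)) :
    (fderiv ℝ (odeDefect V) ((τ, x), u) ∘L .inr ℝ (ℝ × E) C(I, E)).IsInvertible := by
  obtain ⟨D, hDC, hD⟩ := norm_fderiv_le_of_lipschitz_comp V hV hc hC u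
  have h1 : HasFDerivAt (fun u => odeDefect V ((τ, x), u))
      (fderiv ℝ (odeDefect V) ((τ, x), u) ∘L .inr ℝ (ℝ × E) C(I, E)) u :=
    (((contDiff_odeDefect V hV hc).differentiable (by simp)) _).hasFDerivAt.comp u
      (hasFDerivAt_prodMk_right (τ, x) u)
  have h2 : HasFDerivAt (fun u => odeDefect V ((τ, x), u))
      (1 - τ • (primitive E ∘L D)) u := by
    have := ((hasFDerivAt_id u).sub_const (constPath E x)).sub
      (((primitive E).hasFDerivAt.comp u hD).const_smul τ)
    exact this
  rw [h1.unique h2]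
  exact isInvertible_one_sub_smul_comp norm_primitive_le hDC hτ

/-- The fixed-point map is a contraction of ratio `|τ| C`. Uniqueness among all paths, not only
nearby ones, identifies the implicit function with the flow before the flow is known to be
continuous in `x`. -/
theorem eq_of_odeDefect_eq_zero (V : C(E, E)) {C : NNReal} (hC : LipschitzWith C V) {τ : ℝ}
    (hτ : |τ| * C < 1) {x : E} {u v : C(I, E)} (hu : odeDefect V ((τ, x), u) = 0)
    (hv : odeDefect V ((τ, x), v) = 0) : u = v := by
  have h1 : u - v = τ • primitive E (V.comp u - V.comp v) := by
    have : odeDefect V ((τ, x), u) - odeDefect V ((τ, x), v) = 0 := by rw [hu, hv, sub_zero]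
    simp only [odeDefect] at this
    rw [map_sub, smul_sub]
    rw [← sub_eq_zero, ← this]
    abel
  have h2 : ‖V.comp u - V.comp v‖ ≤ C * ‖u - v‖ := by
    refine (ContinuousMap.norm_le _ (by positivity)).2 fun t => ?_
    have := hC.dist_le_mul (u t) (v t)
    rw [dist_eq_norm, dist_eq_norm] at this
    refine this.trans ?_
    gcongr
    exact (u - v).norm_coe_le_norm t
  have h3 : ‖u - v‖ ≤ |τ| * C * ‖u - v‖ := by
    calc ‖u - v‖ = ‖τ • primitive E (V.comp u - V.comp v)‖ := by rw [← h1]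
      _ = |τ| * ‖primitive E (V.comp u - V.comp v)‖ := by rw [norm_smul, Real.norm_eq_abs]
      _ ≤ |τ| * (1 * (C * ‖u - v‖)) := by
        gcongr
        exact (primitive E).le_of_opNorm_le_of_le norm_primitive_le h2
      _ = |τ| * C * ‖u - v‖ := by ring
  have h4 : ‖u - v‖ = 0 := by nlinarith [norm_nonneg (u - v)]
  exact sub_eq_zero.1 (norm_eq_zero.1 h4)

/-- For short times the flow of a smooth compactly supported vector field is smooth. -/
theorem contDiffAt_flow_of_small [CompleteSpace E] (V : C(E, E)) (hV : ContDiff ℝ ∞ V)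
    (hc : HasCompactSupport V) {C : NNReal} (hC : LipschitzWith C V) {γ : ℝ → E → E}
    (h0 : ∀ x, γ 0 x = x) (hd : ∀ x t, HasDerivAt (fun t => γ t x) (V (γ t x)) t)
    {τ : ℝ} (hτ : |τ| * C < 1) (x : E) : ContDiffAt ℝ ∞ (Function.uncurry γ) (τ, x) := by
  have hγ : ∀ x, Continuous fun t => γ t x := fun x =>
    continuous_iff_continuousAt.2 fun t => (hd x t).continuousAt
  have hz := odeDefect_trajectory V hγ h0 hd
  have cdf : ContDiffAt ℝ ∞ (odeDefect V) ((τ, x), trajectory γ hγ τ x) :=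
    (contDiff_odeDefect V hV hc).contDiffAt
  have hinv := fderiv_odeDefect_isInvertible V hV hc hC hτ x (trajectory γ hγ τ x)
  have hsm := cdf.contDiffAt_implicitFunction (by simp) hinv
  have hev := cdf.eventually_apply_implicitFunction (by simp) hinv
  have hnear : ∀ᶠ z : ℝ × E in 𝓝 (τ, x), |z.1| * C < 1 :=
    (((continuous_abs.comp continuous_fst).mul continuous_const).continuousAt).eventually_lt
      continuousAt_const hτ
  refine ((evalOne E).contDiff.contDiffAt.comp _ hsm).congr_of_eventuallyEq ?_
  filter_upwards [hev, hnear] with z h1 h2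
  rw [hz] at h1
  have := eq_of_odeDefect_eq_zero V hC h2 h1 (hz z.1 z.2)
  change γ z.1 z.2 = (cdf.implicitFunction _ hinv z) 1
  rw [this]
  simp [trajectory]

end Flow

/-! ### Global flows of compactly supported vector fields. -/

section Flow

open Set Filter Topology

universe u

variable {E : Type u} [NormedAddCommGroup E] [NormedSpace ℝ E]

/-- A globally Lipschitz bounded vector field has global integral curves. -/
theorem exists_global_integralCurve [CompleteSpace E] {V : E → E} (hV : ContDiff ℝ ∞ V)
    {C : NNReal} (hC : LipschitzWith C V) {B : NNReal} (hB : ∀ x, ‖V x‖ ≤ B) (x : E) :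
    ∃ γ : ℝ → E, γ 0 = x ∧ ∀ t, HasDerivAt γ (V (γ t)) t := by
  have hloc : ∀ x : E, ∃ γ : ℝ → E, γ 0 = x ∧ IsMIntegralCurveOn (I := 𝓘(ℝ, E)) γ V (Ioo (-1) 1) := by
    intro x
    -- Speed at most `B` keeps a solution over `[-1, 1]` within the ball of radius `B`. The
    -- existence time is therefore the same at every point, which is what allows extension to all
    -- times.
    have hpl : IsPicardLindelof (fun _ ↦ V) (⟨0, by norm_num, by norm_num⟩ : Icc (-1 : ℝ) 1) x B 0
        B C := by
      refine IsPicardLindelof.of_time_independent (fun y _ => hB y) hC.lipschitzOnWith ?_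
      simp
    obtain ⟨α, h0, hα⟩ := hpl.exists_eq_forall_mem_Icc_hasDerivWithinAt₀
    refine ⟨α, h0, fun t ht => ?_⟩
    exact ((hα t (Ioo_subset_Icc_self ht)).hasDerivAt
      (Icc_mem_nhds ht.1 ht.2)).hasFDerivAt.hasMFDerivAt.hasMFDerivWithinAt
  have hsec : ContMDiff 𝓘(ℝ, E) 𝓘(ℝ, E).tangent 1
      (fun x => (⟨x, V x⟩ : TangentBundle 𝓘(ℝ, E) E)) :=
    contMDiff_vectorSpace_iff_contDiff.2 (hV.of_le (by norm_cast))
  obtain ⟨γ, h0, hγ⟩ := exists_isMIntegralCurve_of_isMIntegralCurveOn hsec one_pos hloc x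
  refine ⟨γ, h0, fun t => ?_⟩
  have h : HasFDerivAt γ ((1 : ℝ →L[ℝ] ℝ).smulRight (V (γ t))) t := (hγ t).hasFDerivAt
  simpa using h.hasDerivAt

/-- A smooth compactly supported vector field on a Banach space has a smooth global flow. -/
theorem exists_contDiff_flow [CompleteSpace E] {V : E → E} (hV : ContDiff ℝ ∞ V)
    (hc : HasCompactSupport V) :
    ∃ φ : ℝ → E → E, ContDiff ℝ ∞ (Function.uncurry φ) ∧ (∀ y, φ 0 y = y) ∧
      (∀ s t y, φ (s + t) y = φ s (φ t y)) ∧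
      (∀ t y, HasDerivAt (fun t => φ t y) (V (φ t y)) t) ∧
      (∀ y, V y = 0 → ∀ t, φ t y = y) := by
  obtain ⟨C, hC⟩ := ContDiff.lipschitzWith_of_hasCompactSupport hc hV (by simp)
  obtain ⟨B, hB⟩ := hV.continuous.bounded_above_of_compact_support hc
  have hex := exists_global_integralCurve hV hC (B := B.toNNReal)
    (fun x => (hB x).trans (Real.le_coe_toNNReal B))
  choose γ h0 hd using hex
  set φ : ℝ → E → E := fun t y => γ y t
  have huniq : ∀ {f g : ℝ → E}, (∀ t, HasDerivAt f (V (f t)) t) → (∀ t, HasDerivAt g (V (g t)) t) →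
      f 0 = g 0 → f = g := fun hf hg h =>
    ODE_solution_unique_univ (v := fun _ => V) (s := fun _ => univ) (K := C)
      (fun _ => hC.lipschitzOnWith) (fun t => ⟨hf t, mem_univ _⟩) (fun t => ⟨hg t, mem_univ _⟩) h
  have hadd : ∀ s t y, φ (s + t) y = φ s (φ t y) := by
    intro s t y
    refine congrFun (huniq (f := fun s => φ (s + t) y) (g := fun s => φ s (φ t y)) (fun s => ?_)
      (fun s => hd _ s) ?_) s
    · exact (hd y (s + t)).comp_add_const s t
    · simp [φ, h0]
  -- Short-time smoothness spreads to all times by doubling: `φ_τ = φ_{τ/2} ∘ φ_{τ/2}`.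
  have hsmall : ∀ (n : ℕ) (τ : ℝ) (y : E), |τ| * C < 2 ^ n → ContDiffAt ℝ ∞ (Function.uncurry φ) (τ, y) := by
    intro n
    induction n with
    | zero =>
      intro τ y hτ
      exact contDiffAt_flow_of_small ⟨V, hV.continuous⟩ hV hc hC h0 (fun x t => hd x t)
        (by simpa using hτ) y
    | succ n ih =>
      intro τ y hτ
      have hτ' : |τ / 2| * C < 2 ^ n := by
        rw [abs_div, abs_two]
        rw [pow_succ] at hτ
        linarith
      have heq : Function.uncurry φ = fun z : ℝ × E =>
          Function.uncurry φ (z.1 / 2, Function.uncurry φ (z.1 / 2, z.2)) := by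
        funext z
        simp only [Function.uncurry]
        rw [← hadd, add_halves]
      rw [heq]
      have hhalf : ContDiffAt ℝ ∞ (fun z : ℝ × E => z.1 / 2) (τ, y) :=
        (contDiff_fst.div_const 2).contDiffAt
      refine ContDiffAt.comp (τ, y) (ih _ _ hτ') (hhalf.prodMk ?_)
      exact ContDiffAt.comp (τ, y) (ih _ _ hτ') (hhalf.prodMk contDiff_snd.contDiffAt)
  refine ⟨φ, ?_, h0, hadd, fun t y => hd y t, fun y hy t => ?_⟩
  · refine contDiff_iff_contDiffAt.2 fun z => ?_
    obtain ⟨n, hn⟩ := pow_unbounded_of_one_lt (|z.1| * C) one_lt_two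
    exact hsmall n z.1 z.2 hn
  · refine congrFun (huniq (f := fun t => φ t y) (g := fun _ => y) (fun s => hd _ s)
      (fun s => ?_) (h0 y)) t
    rw [hy]
    exact hasDerivAt_const s y

end Flow

/-! ### Pullbacks to vector spaces and the exterior derivative. -/

section Pullback

open Set Filter Topology

variable {W : Type*} [NormedAddCommGroup W] [NormedSpace ℝ W]
  {E : Type*} [NormedAddCommGroup E] [NormedSpace ℝ E]
  {E' : Type*} [NormedAddCommGroup E'] [NormedSpace ℝ E']
  {E'' : Type*} [NormedAddCommGroup E''] [NormedSpace ℝ E'']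
  {M : Type*} [TopologicalSpace M] [ChartedSpace E M]
  {N : Type*} [TopologicalSpace N] [ChartedSpace E' N]
  {P : Type*} [TopologicalSpace P] [ChartedSpace E'' P] {k : ℕ}

theorem pullback_congr {f g : M → N} {x : M} (h : f =ᶠ[𝓝 x] g) (η : Form E' N k) :
    pullback (E := E) f η x = pullback (E := E) g η x :=
  congrArg₂ (fun (a : E' [⋀^Fin k]→L[ℝ] ℝ) (A : E →L[ℝ] E') => a.compContinuousLinearMap A)
    (congrArg (β := E' [⋀^Fin k]→L[ℝ] ℝ) η h.eq_of_nhds) h.mfderiv_eq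

theorem pullback_comp {g : N → P} {f : M → N} {x : M}
    (hg : MDifferentiableAt 𝓘(ℝ, E') 𝓘(ℝ, E'') g (f x))
    (hf : MDifferentiableAt 𝓘(ℝ, E) 𝓘(ℝ, E') f x) (η : Form E'' P k) :
    pullback (E := E) (g ∘ f) η x = pullback (E := E) f (pullback (E := E') g η) x := by
  unfold pullback
  rw [mfderiv_comp x hg hf]
  rfl

/-- The pullback of a form to a vector space, as a map between vector spaces. -/
def flatPullback (Φ : W → M) (η : Form E M k) : W → W [⋀^Fin k]→L[ℝ] ℝ :=
  pullback (E := W) (M := W) Φ η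

theorem flatPullback_apply (Φ : W → M) (η : Form E M k) (z : W) (v : Fin k → W) :
    flatPullback Φ η z v = η (Φ z) fun i => mfderiv 𝓘(ℝ, W) 𝓘(ℝ, E) Φ z (v i) := rfl

theorem mdifferentiableAt_extChartAt_symm_of_mem [IsManifold 𝓘(ℝ, E) ∞ M] {c : M} {y : E}
    (hy : y ∈ (extChartAt 𝓘(ℝ, E) c).target) :
    MDifferentiableAt 𝓘(ℝ, E) 𝓘(ℝ, E) (extChartAt 𝓘(ℝ, E) c).symm y :=
  ((contMDiffOn_extChartAt_symm (n := ∞) c).contMDiffAt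
    ((isOpen_extChartAt_target c).mem_nhds hy)).mdifferentiableAt (by simp)

section Local

variable [IsManifold 𝓘(ℝ, E) ∞ M] {U : Set W} {Φ : W → M}

theorem contDiffAt_extChartAt_comp (hU : IsOpen U)
    (hΦ : ContMDiffOn 𝓘(ℝ, W) 𝓘(ℝ, E) ∞ Φ U) {z : W} (hz : z ∈ U) {c : M}
    (hc : Φ z ∈ (extChartAt 𝓘(ℝ, E) c).source) :
    ContDiffAt ℝ ∞ (extChartAt 𝓘(ℝ, E) c ∘ Φ) z := by
  rw [← contMDiffAt_iff_contDiffAt]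
  rw [extChartAt_source] at hc
  exact (contMDiffAt_extChartAt' hc).comp z (hΦ.contMDiffAt (hU.mem_nhds hz))

/-- Near `z` one has `Φ = e⁻¹ ∘ (e ∘ Φ)` for the chart `e` at `c`. The pullback thus becomes one
between vector spaces, where the calculus of `extDeriv` applies. -/
theorem eventually_pullback_eq (hU : IsOpen U) (hΦ : ContMDiffOn 𝓘(ℝ, W) 𝓘(ℝ, E) ∞ Φ U)
    {z : W} (hz : z ∈ U) {c : M} (hc : Φ z ∈ (extChartAt 𝓘(ℝ, E) c).source) (η : Form E M k) :
    ∀ᶠ z' in 𝓝 z, flatPullback Φ η z' =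
      (chartForm η c ((extChartAt 𝓘(ℝ, E) c ∘ Φ) z')).compContinuousLinearMap
        (fderiv ℝ (extChartAt 𝓘(ℝ, E) c ∘ Φ) z') := by
  have hsrc : ∀ᶠ z' in 𝓝 z, Φ z' ∈ (extChartAt 𝓘(ℝ, E) c).source :=
    (hΦ.continuousOn.continuousAt (hU.mem_nhds hz)).eventually
      ((isOpen_extChartAt_source c).mem_nhds hc)
  filter_upwards [hU.mem_nhds hz, hsrc.eventually_nhds] with z' hz' hs
  have hs' := hs.self_of_nhds
  have hcongr : Φ =ᶠ[𝓝 z'] (extChartAt 𝓘(ℝ, E) c).symm ∘ (extChartAt 𝓘(ℝ, E) c ∘ Φ) := by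
    filter_upwards [hs] with w hw
    exact ((extChartAt 𝓘(ℝ, E) c).left_inv hw).symm
  have hu : DifferentiableAt ℝ (extChartAt 𝓘(ℝ, E) c ∘ Φ) z' :=
    (contDiffAt_extChartAt_comp hU hΦ hz' hs').differentiableAt (by simp)
  have h1 := pullback_congr (E := W) hcongr η
  have h2 := pullback_comp (E := W) (x := z') (mdifferentiableAt_extChartAt_symm_of_mem
    ((extChartAt 𝓘(ℝ, E) c).map_source hs')) hu.mdifferentiableAt η
  refine (h1.trans h2).trans ?_
  rw [← mfderiv_eq_fderiv]
  rfl

variable {η : Form E M k}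

omit [IsManifold 𝓘(ℝ, E) ∞ M] in
theorem IsSmooth.contDiffAt_chartForm (hη : IsSmooth η) {c : M} {y : E}
    (hy : y ∈ (extChartAt 𝓘(ℝ, E) c).target) : ContDiffAt ℝ ∞ (chartForm η c) y :=
  (hη c).contDiffAt ((isOpen_extChartAt_target c).mem_nhds hy)

/-- The pullback of a smooth form to an open subset of a vector space is differentiable. -/
theorem differentiableAt_pullback (hη : IsSmooth η) (hU : IsOpen U)
    (hΦ : ContMDiffOn 𝓘(ℝ, W) 𝓘(ℝ, E) ∞ Φ U) {z : W} (hz : z ∈ U) :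
    DifferentiableAt ℝ (flatPullback Φ η) z := by
  have hc := mem_extChartAt_source (I := 𝓘(ℝ, E)) (Φ z)
  have hu := contDiffAt_extChartAt_comp hU hΦ hz hc
  refine DifferentiableAt.congr_of_eventuallyEq ?_ (eventually_pullback_eq hU hΦ hz hc η)
  refine (HasFDerivAt.continuousAlternatingMapCompContinuousLinearMap
    (DifferentiableAt.hasFDerivAt ?_) (DifferentiableAt.hasFDerivAt ?_)).differentiableAt
  · exact DifferentiableAt.comp z ((hη.contDiffAt_chartForm
      ((extChartAt 𝓘(ℝ, E) (Φ z)).map_source hc)).differentiableAt (by simp))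
      (hu.differentiableAt (by simp))
  · exact (hu.fderiv_right (m := 1) (by norm_cast)).differentiableAt (by simp)

/-- The exterior derivative commutes with pullbacks to open subsets of vector spaces. -/
theorem extDeriv_pullback_eq (hη : IsSmooth η) (hU : IsOpen U)
    (hΦ : ContMDiffOn 𝓘(ℝ, W) 𝓘(ℝ, E) ∞ Φ U) {z : W} (hz : z ∈ U) :
    extDeriv (flatPullback Φ η) z = flatPullback Φ (extD η) z := by
  have hc := mem_extChartAt_source (I := 𝓘(ℝ, E)) (Φ z)
  have hu := contDiffAt_extChartAt_comp hU hΦ hz hc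
  rw [Filter.EventuallyEq.extDeriv_eq (eventually_pullback_eq hU hΦ hz hc η)]
  have h1 := extDeriv_pullback (r := ∞)
    (f := extChartAt 𝓘(ℝ, E) (Φ z) ∘ Φ) (x := z)
    ((hη.contDiffAt_chartForm ((extChartAt 𝓘(ℝ, E) (Φ z)).map_source hc)).differentiableAt
      (by simp)) hu (by simpa using (by norm_cast : (2 : WithTop ℕ∞) ≤ ∞))
  rw [h1, ← mfderiv_eq_fderiv, mfderiv_comp z (mdifferentiableAt_extChartAt
    (mem_chart_source E (Φ z)))
    ((hΦ.contMDiffAt (hU.mem_nhds hz)).mdifferentiableAt (by simp))]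
  rfl

end Local

end Pullback

/-! ### Hamiltonian flows swept over parametrised pieces of the manifold. -/

section HamiltonianFlow

open Set Filter Topology

variable {W : Type*} [NormedAddCommGroup W] [NormedSpace ℝ W]
  {E : Type*} [NormedAddCommGroup E] [NormedSpace ℝ E]
  {M : Type*} [TopologicalSpace M] [ChartedSpace E M]
  {Φ : ℝ × M → M} {H : M → ℝ}

theorem extDeriv_apply_two {β : W → W [⋀^Fin 1]→L[ℝ] ℝ} {z : W} (h : DifferentiableAt ℝ β z)
    (e v : W) : extDeriv β z ![e, v] =
      fderiv ℝ (fun z => β z ![v]) z e - fderiv ℝ (fun z => β z ![e]) z v := by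
  have h0 : Fin.removeNth 0 ![e, v] = ![v] := by ext i; fin_cases i; rfl
  have h1 : Fin.removeNth 1 ![e, v] = ![e] := by ext i; fin_cases i; rfl
  rw [extDeriv_apply h, Fin.sum_univ_two, h0, h1]
  simp [sub_eq_add_neg]

theorem extDeriv_apply_three {β : W → W [⋀^Fin 2]→L[ℝ] ℝ} {z : W} (h : DifferentiableAt ℝ β z)
    (e v w : W) : extDeriv β z ![e, v, w] =
      fderiv ℝ (fun z => β z ![v, w]) z e - fderiv ℝ (fun z => β z ![e, w]) z v +
        fderiv ℝ (fun z => β z ![e, v]) z w := by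
  have h0 : Fin.removeNth 0 ![e, v, w] = ![v, w] := by ext i; fin_cases i <;> rfl
  have h1 : Fin.removeNth 1 ![e, v, w] = ![e, w] := by ext i; fin_cases i <;> rfl
  have h2 : Fin.removeNth 2 ![e, v, w] = ![e, v] := by ext i; fin_cases i <;> rfl
  rw [extDeriv_apply h, Fin.sum_univ_three, h0, h1, h2]
  simp [sub_eq_add_neg]

/-- The family of maps `Φ (s, ·)` restricted to a parametrised piece of `M`. -/
def sweep (Φ : ℝ × M → M) (c : W → M) (z : ℝ × W) : M := Φ (z.1, c z.2)

theorem contMDiffOn_sweep (hΦ : ContMDiff (𝓘(ℝ, ℝ).prod 𝓘(ℝ, E)) 𝓘(ℝ, E) ∞ Φ) {c : W → M}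
    {U : Set W} (hc : ContMDiffOn 𝓘(ℝ, W) 𝓘(ℝ, E) ∞ c U) :
    ContMDiffOn 𝓘(ℝ, ℝ × W) 𝓘(ℝ, E) ∞ (sweep Φ c) (univ ×ˢ U) := by
  have h1 : ContMDiffOn 𝓘(ℝ, ℝ × W) 𝓘(ℝ, ℝ) ∞ (fun z : ℝ × W => z.1) (univ ×ˢ U) :=
    contDiff_fst.contMDiff.contMDiffOn
  have h2 : ContMDiffOn 𝓘(ℝ, ℝ × W) 𝓘(ℝ, E) ∞ (fun z : ℝ × W => c z.2) (univ ×ˢ U) :=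
    hc.comp contDiff_snd.contMDiff.contMDiffOn fun z hz => hz.2
  exact hΦ.comp_contMDiffOn (h1.prodMk h2)

theorem mfderiv_sweep_time {c : W → M} {s : ℝ} {w : W}
    (h : MDifferentiableAt 𝓘(ℝ, ℝ × W) 𝓘(ℝ, E) (sweep Φ c) (s, w)) :
    mfderiv 𝓘(ℝ, ℝ × W) 𝓘(ℝ, E) (sweep Φ c) (s, w) ((1 : ℝ), (0 : W)) =
      mfderiv 𝓘(ℝ, ℝ) 𝓘(ℝ, E) (fun r => Φ (r, c w)) s (1 : ℝ) := by
  have h1 := hasFDerivAt_prodMk_left (𝕜 := ℝ) s w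
  have h2 := mfderiv_comp (I := 𝓘(ℝ, ℝ)) (I' := 𝓘(ℝ, ℝ × W)) (I'' := 𝓘(ℝ, E))
    (f := fun r : ℝ => (r, w)) s h h1.differentiableAt.mdifferentiableAt
  rw [mfderiv_eq_fderiv, h1.fderiv] at h2
  exact (DFunLike.congr_fun h2 (1 : ℝ)).symm

theorem mfderiv_sweep_space {c : W → M} {s : ℝ} {w : W}
    (h : MDifferentiableAt 𝓘(ℝ, ℝ × W) 𝓘(ℝ, E) (sweep Φ c) (s, w)) (v : W) :
    mfderiv 𝓘(ℝ, ℝ × W) 𝓘(ℝ, E) (sweep Φ c) (s, w) ((0 : ℝ), v) =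
      mfderiv 𝓘(ℝ, W) 𝓘(ℝ, E) (fun w => Φ (s, c w)) w v := by
  have h1 := hasFDerivAt_prodMk_right (𝕜 := ℝ) s w
  have h2 := mfderiv_comp (I := 𝓘(ℝ, W)) (I' := 𝓘(ℝ, ℝ × W)) (I'' := 𝓘(ℝ, E))
    (f := fun w : W => (s, w)) w h h1.differentiableAt.mdifferentiableAt
  rw [mfderiv_eq_fderiv, h1.fderiv] at h2
  exact (DFunLike.congr_fun h2 v).symm

/-- `Φ` solves Hamilton's equation `η(∂ₛΦ, ·) = dH`. -/
def SolvesHamilton (η : Form E M 2) (H : M → ℝ) (Φ : ℝ × M → M) : Prop :=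
  ∀ (s : ℝ) (q : M) (w : TangentSpace 𝓘(ℝ, E) (Φ (s, q))),
    η (Φ (s, q)) ![mfderiv 𝓘(ℝ, ℝ) 𝓘(ℝ, E) (fun r : ℝ => Φ (r, q)) s (1 : ℝ), w] =
      mfderiv 𝓘(ℝ, E) 𝓘(ℝ, ℝ) H (Φ (s, q)) w

/-- Contracting the pulled-back form with `∂_s` gives the differential of `H ∘ sweep` in every
direction `v`, time included. Both the invariance of the form and the integral formula rest on this
identity. -/
theorem flatPullback_sweep_time {η : Form E M 2} (hham : SolvesHamilton η H Φ)
    (hH : ContMDiff 𝓘(ℝ, E) 𝓘(ℝ, ℝ) ∞ H) {c : W → M} {z : ℝ × W}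
    (h : MDifferentiableAt 𝓘(ℝ, ℝ × W) 𝓘(ℝ, E) (sweep Φ c) z) (v : ℝ × W) :
    flatPullback (sweep Φ c) η z ![((1 : ℝ), (0 : W)), v] = fderiv ℝ (H ∘ sweep Φ c) z v := by
  obtain ⟨s, w⟩ := z
  rw [flatPullback_apply, ← mfderiv_eq_fderiv,
    mfderiv_comp (I' := 𝓘(ℝ, E)) (s, w) (hH.mdifferentiable (by simp) _) h]
  refine Eq.trans ?_ (hham s (c w) (mfderiv 𝓘(ℝ, ℝ × W) 𝓘(ℝ, E) (sweep Φ c) (s, w) v))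
  refine congrArg (η (sweep Φ c (s, w))) ?_
  ext i
  fin_cases i
  · exact mfderiv_sweep_time h
  · rfl

end HamiltonianFlow

/-! ### Invariance of the two-form, and the integral formula by Green's theorem. -/

section HamiltonianFlow

open Set Filter Topology MeasureTheory

variable {W : Type*} [NormedAddCommGroup W] [NormedSpace ℝ W]
  {E : Type*} [NormedAddCommGroup E] [NormedSpace ℝ E]
  {M : Type*} [TopologicalSpace M] [ChartedSpace E M] [IsManifold 𝓘(ℝ, E) ∞ M]
  {Φ : ℝ × M → M} {H : M → ℝ}

omit [IsManifold 𝓘(ℝ, E) ∞ M] in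
theorem contDiffOn_comp_sweep (hΦ : ContMDiff (𝓘(ℝ, ℝ).prod 𝓘(ℝ, E)) 𝓘(ℝ, E) ∞ Φ)
    (hH : ContMDiff 𝓘(ℝ, E) 𝓘(ℝ, ℝ) ∞ H) {c : W → M} {U : Set W}
    (hc : ContMDiffOn 𝓘(ℝ, W) 𝓘(ℝ, E) ∞ c U) :
    ContDiffOn ℝ ∞ (H ∘ sweep Φ c) (univ ×ˢ U) :=
  contMDiffOn_iff_contDiffOn.1 (hH.comp_contMDiffOn (contMDiffOn_sweep hΦ hc))

/-- The Lie derivative of a closed two-form along its Hamiltonian flow vanishes. -/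
theorem fderiv_flatPullback_sweep {η : Form E M 2} (hη : IsSmooth η) (hcl : extD η = 0)
    (hΦ : ContMDiff (𝓘(ℝ, ℝ).prod 𝓘(ℝ, E)) 𝓘(ℝ, E) ∞ Φ)
    (hH : ContMDiff 𝓘(ℝ, E) 𝓘(ℝ, ℝ) ∞ H) (hham : SolvesHamilton η H Φ)
    {c : W → M} {U : Set W} (hU : IsOpen U) (hc : ContMDiffOn 𝓘(ℝ, W) 𝓘(ℝ, E) ∞ c U)
    {z : ℝ × W} (hz : z.2 ∈ U) (v w : ℝ × W) :
    fderiv ℝ (fun z => flatPullback (sweep Φ c) η z ![v, w]) z ((1 : ℝ), (0 : W)) = 0 := by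
  have hO : IsOpen ((univ : Set ℝ) ×ˢ U) := isOpen_univ.prod hU
  have hzO : z ∈ (univ : Set ℝ) ×ˢ U := ⟨mem_univ _, hz⟩
  have hΨ := contMDiffOn_sweep hΦ hc
  have hd := differentiableAt_pullback hη hO hΨ hzO
  have hclosed : extDeriv (flatPullback (sweep Φ c) η) z ![((1 : ℝ), (0 : W)), v, w] = 0 := by
    rw [extDeriv_pullback_eq hη hO hΨ hzO, hcl]
    rfl
  have htime : ∀ v : ℝ × W, (fun z => flatPullback (sweep Φ c) η z ![((1 : ℝ), (0 : W)), v])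
      =ᶠ[𝓝 z] fun z => fderiv ℝ (H ∘ sweep Φ c) z v := by
    intro v
    filter_upwards [hO.mem_nhds hzO] with z' hz'
    exact flatPullback_sweep_time hham hH
      ((hΨ.contMDiffAt (hO.mem_nhds hz')).mdifferentiableAt (by simp)) v
  have hsm : ContDiffAt ℝ ∞ (H ∘ sweep Φ c) z :=
    (contDiffOn_comp_sweep hΦ hH hc).contDiffAt (hO.mem_nhds hzO)
  have hdd : DifferentiableAt ℝ (fderiv ℝ (H ∘ sweep Φ c)) z :=
    (hsm.fderiv_right (m := 1) (by norm_cast)).differentiableAt (by simp)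
  have hsymm := (hsm.isSymmSndFDerivAt (by simpa using (by norm_cast : (2 : WithTop ℕ∞) ≤ ∞))) v w
  have happ : ∀ a b : ℝ × W, fderiv ℝ (fun z => fderiv ℝ (H ∘ sweep Φ c) z a) z b =
      fderiv ℝ (fderiv ℝ (H ∘ sweep Φ c)) z b a := fun a b => by
    rw [fderiv_clm_apply hdd (differentiableAt_const a)]
    simp
  -- With `h = H ∘ sweep`, closedness reads `∂_s ω(v, w) = ∂_v ∂_w h - ∂_w ∂_v h`, which vanishes by
  -- symmetry of the second derivative.
  rw [extDeriv_apply_three hd, (htime w).fderiv_eq, (htime v).fderiv_eq, happ, happ] at hclosed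
  linarith

/-- The flow of a Hamiltonian preserves the (closed) two-form. -/
theorem pullback_flow_eq {η : Form E M 2} (hη : IsSmooth η) (hcl : extD η = 0)
    (hΦ : ContMDiff (𝓘(ℝ, ℝ).prod 𝓘(ℝ, E)) 𝓘(ℝ, E) ∞ Φ)
    (hH : ContMDiff 𝓘(ℝ, E) 𝓘(ℝ, ℝ) ∞ H) (hham : SolvesHamilton η H Φ)
    (h0 : ∀ q, Φ (0, q) = q) (s : ℝ) :
    pullback (E := E) (fun q => Φ (s, q)) η = η := by
  funext q
  set e := extChartAt 𝓘(ℝ, E) q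
  have hc : ContMDiffOn 𝓘(ℝ, E) 𝓘(ℝ, E) ∞ e.symm e.target := contMDiffOn_extChartAt_symm q
  have hU : IsOpen e.target := isOpen_extChartAt_target q
  have hy : e q ∈ e.target := mem_extChartAt_target q
  have he : MDifferentiableAt 𝓘(ℝ, E) 𝓘(ℝ, E) e q :=
    mdifferentiableAt_extChartAt (mem_chart_source E q)
  have hΨ : ∀ s : ℝ, MDifferentiableAt 𝓘(ℝ, ℝ × E) 𝓘(ℝ, E) (sweep Φ e.symm) (s, e q) := fun s =>
    ((contMDiffOn_sweep hΦ hc).contMDiffAt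
      ((isOpen_univ.prod hU).mem_nhds ⟨mem_univ s, hy⟩)).mdifferentiableAt (by simp)
  -- Near `q` the time-`s` map is `sweep` after the slice `y ↦ (s, y)` after the chart. Only the
  -- base point `(s, e q)` on the right depends on `s`, not the vectors.
  have key : ∀ (s : ℝ) (v : Fin 2 → E), pullback (E := E) (fun q => Φ (s, q)) η q v =
      flatPullback (sweep Φ e.symm) η (s, e q)
        ![((0 : ℝ), mfderiv 𝓘(ℝ, E) 𝓘(ℝ, E) e q (v 0)),
          ((0 : ℝ), mfderiv 𝓘(ℝ, E) 𝓘(ℝ, E) e q (v 1))] := by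
    intro s v
    have h1 := hasFDerivAt_prodMk_right (𝕜 := ℝ) s (e q)
    have hj : MDifferentiableAt 𝓘(ℝ, E) 𝓘(ℝ, ℝ × E) ((fun y : E => (s, y)) ∘ e) q :=
      MDifferentiableAt.comp q (I' := 𝓘(ℝ, E)) h1.differentiableAt.mdifferentiableAt he
    have hcongr : (fun q => Φ (s, q)) =ᶠ[𝓝 q] sweep Φ e.symm ∘ ((fun y : E => (s, y)) ∘ e) := by
      filter_upwards [extChartAt_source_mem_nhds (I := 𝓘(ℝ, E)) q] with q' hq'
      simp only [sweep, Function.comp_apply]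
      rw [e.left_inv hq']
    have h2 := pullback_congr (E := E) hcongr η
    have h3 := pullback_comp (E := E) (x := q) (hΨ s) hj η
    have h4 := mfderiv_comp (I' := 𝓘(ℝ, E)) (I'' := 𝓘(ℝ, ℝ × E)) q
      h1.differentiableAt.mdifferentiableAt he
    rw [mfderiv_eq_fderiv, h1.fderiv] at h4
    rw [h2.trans h3]
    refine congrArg (flatPullback (sweep Φ e.symm) η (s, e q)) ?_
    ext1 i
    fin_cases i
    · exact DFunLike.congr_fun h4 (v 0)
    · exact DFunLike.congr_fun h4 (v 1)
  have hconst : ∀ v w : ℝ × E, flatPullback (sweep Φ e.symm) η (s, e q) ![v, w] =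
      flatPullback (sweep Φ e.symm) η (0, e q) ![v, w] := by
    intro v w
    have hder : ∀ s : ℝ, HasDerivAt
        (fun s => flatPullback (sweep Φ e.symm) η (s, e q) ![v, w]) 0 s := by
      intro s
      have hd : DifferentiableAt ℝ (fun z => flatPullback (sweep Φ e.symm) η z ![v, w])
          (s, e q) :=
        (differentiableAt_pullback hη (isOpen_univ.prod hU) (contMDiffOn_sweep hΦ hc)
          ⟨mem_univ s, hy⟩).continuousAlternatingMap_apply_const _
      have := hd.hasFDerivAt.comp_hasDerivAt s (hasFDerivAt_prodMk_left (𝕜 := ℝ) s (e q)).hasDerivAt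
      simp only [ContinuousLinearMap.inl_apply] at this
      rwa [fderiv_flatPullback_sweep hη hcl hΦ hH hham hU hc hy] at this
    exact is_const_of_deriv_eq_zero (fun s => (hder s).differentiableAt)
      (fun s => (hder s).deriv) s 0
  have hid : (fun q => Φ (0, q)) = id := funext h0
  refine ContinuousAlternatingMap.ext fun v => ?_
  have h5 := key s v
  rw [hconst, ← key 0 v, hid] at h5
  refine h5.trans ?_
  simp only [pullback, mfderiv_id]
  rfl

/-- Hamilton's equation integrates the one-form `Φ₁^*λ - λ` along any path between fixed points. -/
theorem pathIntegral_pullback_flow_sub {lam : Form E M 1} (hlam : IsSmooth lam)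
    (hΦ : ContMDiff (𝓘(ℝ, ℝ).prod 𝓘(ℝ, E)) 𝓘(ℝ, E) ∞ Φ)
    (hH : ContMDiff 𝓘(ℝ, E) 𝓘(ℝ, ℝ) ∞ H) (hham : SolvesHamilton (extD lam) H Φ)
    (h0 : ∀ q, Φ (0, q) = q) {γ : ℝ → M} {x y : M} (hγ : IsSmoothPath E γ x y)
    (hx : ∀ s, Φ (s, x) = x) (hy : ∀ s, Φ (s, y) = y) :
    pathIntegral (pullback (E := E) (fun q => Φ (1, q)) lam - lam) γ = H y - H x := by
  obtain ⟨hγs, hγ0, hγ1⟩ := hγ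
  have hΨ : ContMDiffOn 𝓘(ℝ, ℝ × ℝ) 𝓘(ℝ, E) ∞ (sweep Φ γ) univ := by
    simpa using contMDiffOn_sweep hΦ hγs.contMDiffOn (U := univ)
  have hΨd : ∀ z, MDifferentiableAt 𝓘(ℝ, ℝ × ℝ) 𝓘(ℝ, E) (sweep Φ γ) z := fun z =>
    (hΨ.contMDiffAt univ_mem).mdifferentiableAt (by simp)
  have hh : ContDiff ℝ ∞ (H ∘ sweep Φ γ) := by
    have := contDiffOn_comp_sweep hΦ hH hγs.contMDiffOn (U := univ)
    rwa [univ_prod_univ, contDiffOn_univ] at this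
  set β := flatPullback (sweep Φ γ) lam
  have hβ : Differentiable ℝ β := fun z => differentiableAt_pullback hlam isOpen_univ hΨ (mem_univ z)
  have hβa : ∀ v : ℝ × ℝ, Differentiable ℝ fun z => β z ![v] := fun v z =>
    (hβ z).continuousAlternatingMap_apply_const _
  -- On the strip swept by `γ`, `dβ(∂_s, ∂_t) = ∂_t h` with `h = H ∘ sweep`. Hence the field
  -- `(β(∂_t), -(β(∂_s) + h))` is divergence free, and its flux through the unit square is zero.
  have hdiv : ∀ z : ℝ × ℝ, fderiv ℝ (fun z => β z ![((0 : ℝ), (1 : ℝ))]) z (1, 0) +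
      fderiv ℝ (fun z => -(β z ![((1 : ℝ), (0 : ℝ))] + (H ∘ sweep Φ γ) z)) z (0, 1) = 0 := by
    intro z
    have h1 := extDeriv_apply_two (hβ z) (1, 0) (0, 1)
    rw [extDeriv_pullback_eq hlam isOpen_univ hΨ (mem_univ z),
      flatPullback_sweep_time hham hH (hΨd z)] at h1
    rw [fderiv_fun_neg, fderiv_fun_add (hβa _ z) (hh.differentiable (by simp) z)]
    simp only [neg_apply, add_apply]
    linarith
  have hga : Differentiable ℝ fun z => -(β z ![((1 : ℝ), (0 : ℝ))] + (H ∘ sweep Φ γ) z) :=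
    ((hβa _).add (hh.differentiable (by simp))).neg
  have green := integral2_divergence_prod_of_hasFDerivAt
    (fun z => β z ![((0 : ℝ), (1 : ℝ))])
    (fun z => -(β z ![((1 : ℝ), (0 : ℝ))] + (H ∘ sweep Φ γ) z)) _ _ 0 0 1 1
    (hβa _).continuous.continuousOn hga.continuous.continuousOn
    (fun z _ => (hβa _ z).hasFDerivAt) (fun z _ => (hga z).hasFDerivAt)
    (by simp only [hdiv]; exact integrableOn_zero)
  simp only [hdiv, intervalIntegral.integral_zero] at green
  -- On the two sides swept by fixed endpoints the velocity is zero, so `β(∂_s) = 0` and only the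
  -- constant `H q` remains.
  have hend : ∀ t q, γ t = q → (∀ s, Φ (s, q) = q) →
      ∫ s in (0 : ℝ)..1, -(β (s, t) ![((1 : ℝ), (0 : ℝ))] + (H ∘ sweep Φ γ) (s, t)) = -H q := by
    intro t q hq hfix
    have : ∀ s : ℝ, -(β (s, t) ![((1 : ℝ), (0 : ℝ))] + (H ∘ sweep Φ γ) (s, t)) = -H q := by
      intro s
      have h1 : β (s, t) ![((1 : ℝ), (0 : ℝ))] = 0 := by
        refine ContinuousAlternatingMap.map_coord_zero (f := lam (sweep Φ γ (s, t))) 0 ?_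
        refine (mfderiv_sweep_time (hΨd (s, t))).trans ?_
        have : (fun r => Φ (r, γ t)) = fun _ => q := funext fun r => by rw [hq, hfix]
        rw [this, mfderiv_const]
        rfl
      rw [h1, zero_add, Function.comp_apply, sweep, hq, hfix]
    simp only [this]
    simp
  rw [hend 1 y hγ1 hy, hend 0 x hγ0 hx] at green
  have hb1 : ∀ t, β (1, t) ![((0 : ℝ), (1 : ℝ))] =
      pullback (E := E) (fun q => Φ (1, q)) lam (γ t)
        ![mfderiv 𝓘(ℝ, ℝ) 𝓘(ℝ, E) γ t (1 : ℝ)] := by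
    intro t
    refine congrArg (lam (Φ (1, γ t))) ?_
    ext i
    fin_cases i
    refine (mfderiv_sweep_space (hΨd (1, t)) (1 : ℝ)).trans ?_
    have hΦ1 : MDifferentiableAt 𝓘(ℝ, E) 𝓘(ℝ, E) (fun q => Φ (1, q)) (γ t) :=
      (hΦ.comp (contMDiff_const.prodMk contMDiff_id)).mdifferentiable (by simp) _
    exact DFunLike.congr_fun (mfderiv_comp t hΦ1 (hγs.mdifferentiable (by simp) t)) (1 : ℝ)
  have hb0 : ∀ t, β (0, t) ![((0 : ℝ), (1 : ℝ))] =
      lam (γ t) ![mfderiv 𝓘(ℝ, ℝ) 𝓘(ℝ, E) γ t (1 : ℝ)] := by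
    intro t
    have h2 : (fun w => Φ (0, γ w)) = γ := funext fun w => h0 _
    have h3 : ∀ (q q' : M) (v v' : E), q = q' → v = v' →
        (lam q : E [⋀^Fin 1]→L[ℝ] ℝ) ![v] = (lam q' : E [⋀^Fin 1]→L[ℝ] ℝ) ![v'] := by
      rintro q q' v v' rfl rfl; rfl
    have h4 := h3 (sweep Φ γ (0, t)) (γ t)
      (mfderiv 𝓘(ℝ, ℝ × ℝ) 𝓘(ℝ, E) (sweep Φ γ) (0, t) ((0 : ℝ), (1 : ℝ)))
      (mfderiv 𝓘(ℝ, ℝ) 𝓘(ℝ, E) γ t (1 : ℝ)) (h0 _)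
      ((mfderiv_sweep_space (hΨd (0, t)) (1 : ℝ)).trans (by rw [h2]; rfl))
    refine Eq.trans (congrArg (lam (sweep Φ γ (0, t))) ?_) h4
    ext i; fin_cases i; rfl
  have hint : ∀ s : ℝ, IntervalIntegrable (fun t => β (s, t) ![((0 : ℝ), (1 : ℝ))]) volume 0 1 :=
    fun s => ((hβa _).continuous.comp (by fun_prop : Continuous fun t : ℝ => (s, t))).intervalIntegrable
      _ _
  have hfinal : pathIntegral (pullback (E := E) (fun q => Φ (1, q)) lam - lam) γ =
      ∫ t in (0 : ℝ)..1, (β (1, t) ![((0 : ℝ), (1 : ℝ))] - β (0, t) ![((0 : ℝ), (1 : ℝ))]) := by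
    unfold pathIntegral
    refine intervalIntegral.integral_congr fun t _ => ?_
    rw [hb1, hb0]
    rfl
  rw [hfinal, intervalIntegral.integral_sub (hint 1) (hint 0)]
  linarith

end HamiltonianFlow

/-! ### Hamiltonian vector fields on the model space. -/

section HamiltonianVectorField

open Set Filter Topology

universe u

variable {E : Type u} [NormedAddCommGroup E] [NormedSpace ℝ E]

theorem update_pair_one {α : Type*} (a b c : α) : Function.update ![a, b] 1 c = ![a, c] := by
  funext i
  fin_cases i <;> rfl

/-- The map `v ↦ A(v, ·)` attached to a two-form on a normed space. -/
def flatMap (A : E [⋀^Fin 2]→L[ℝ] ℝ) : E →L[ℝ] E →L[ℝ] ℝ :=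
  LinearMap.mkContinuous₂
    (LinearMap.mk₂ ℝ (fun v w : E => A ![v, w])
      (fun v v' w => A.toMultilinearMap.cons_add ![w] v v')
      (fun c v w => A.toMultilinearMap.cons_smul ![w] c v)
      (fun v w w' => by
        have := A.map_update_add ![v, 0] 1 w w'
        simpa only [update_pair_one] using this)
      (fun c v w => by
        have := A.map_update_smul ![v, 0] 1 c w
        simpa only [update_pair_one] using this)) ‖A‖
    (fun v w => by
      refine (A.le_opNorm ![v, w]).trans (le_of_eq ?_)
      rw [Fin.prod_univ_two, mul_assoc]
      rfl)

@[simp]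
theorem flatMap_apply (A : E [⋀^Fin 2]→L[ℝ] ℝ) (v w : E) : flatMap A v w = A ![v, w] := rfl

theorem isBoundedLinearMap_flatMap : IsBoundedLinearMap ℝ (flatMap (E := E)) :=
  IsLinearMap.with_bound ⟨fun _ _ => rfl, fun _ _ => rfl⟩ 1 fun A => by
    rw [one_mul]
    exact LinearMap.mkContinuous₂_norm_le _ (norm_nonneg A) _

theorem contDiff_flatMap : ContDiff ℝ ∞ (flatMap (E := E)) :=
  isBoundedLinearMap_flatMap.contDiff

theorem flatMap_isInvertible [FiniteDimensional ℝ E] {A : E [⋀^Fin 2]→L[ℝ] ℝ}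
    (hA : ∀ v, (∀ w, A ![v, w] = 0) → v = 0) : (flatMap A).IsInvertible := by
  have hinj : Function.Injective (flatMap A : E →ₗ[ℝ] (E →L[ℝ] ℝ)) := by
    refine (injective_iff_map_eq_zero _).2 fun v hv => hA v fun w => ?_
    exact DFunLike.congr_fun hv w
  have hdim : Module.finrank ℝ E = Module.finrank ℝ (E →L[ℝ] ℝ) := by
    rw [← (LinearMap.toContinuousLinearMap (𝕜 := ℝ) (E := E) (F' := ℝ)).finrank_eq]
    exact Subspace.dual_finrank_eq.symm
  have : FiniteDimensional ℝ (E →L[ℝ] ℝ) :=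
    (LinearMap.toContinuousLinearMap (𝕜 := ℝ) (E := E) (F' := ℝ)).finiteDimensional
  exact ⟨(LinearMap.linearEquivOfInjective _ hinj hdim).toContinuousLinearEquiv, rfl⟩

/-- The Hamiltonian vector field of `k` with respect to a two-form `ω` on a vector space. -/
def hamVectorField (w : E → E [⋀^Fin 2]→L[ℝ] ℝ) (k : E → ℝ) (y : E) : E :=
  (flatMap (w y)).inverse (fderiv ℝ k y)

theorem hamVectorField_eq_zero (w : E → E [⋀^Fin 2]→L[ℝ] ℝ) {k : E → ℝ} {y : E}
    (h : fderiv ℝ k y = 0) : hamVectorField w k y = 0 := by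
  rw [hamVectorField, h, map_zero]

theorem apply_hamVectorField {w : E → E [⋀^Fin 2]→L[ℝ] ℝ} {k : E → ℝ} {y : E}
    (h : (flatMap (w y)).IsInvertible) (v : E) :
    w y ![hamVectorField w k y, v] = fderiv ℝ k y v := by
  rw [← flatMap_apply, hamVectorField, h.self_apply_inverse]

theorem tsupport_hamVectorField_subset (w : E → E [⋀^Fin 2]→L[ℝ] ℝ) (k : E → ℝ) :
    tsupport (hamVectorField w k) ⊆ tsupport k := by
  refine closure_minimal (fun y hy => ?_) (isClosed_tsupport k)
  refine support_fderiv_subset ℝ fun h => hy (hamVectorField_eq_zero w ?_)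
  exact h

theorem contDiff_hamVectorField [FiniteDimensional ℝ E] {w : E → E [⋀^Fin 2]→L[ℝ] ℝ}
    {k : E → ℝ} {U : Set E} (hU : IsOpen U) (hw : ContDiffOn ℝ ∞ w U)
    (hinv : ∀ y ∈ U, (flatMap (w y)).IsInvertible) (hk : ContDiff ℝ ∞ k) (hkU : tsupport k ⊆ U) :
    ContDiff ℝ ∞ (hamVectorField w k) := by
  have := FiniteDimensional.complete ℝ E
  refine contDiff_iff_contDiffAt.2 fun y => ?_
  -- On the support of `k` the form is smooth and invertible; off it the field is locally zero,
  -- whatever `w` is there.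
  by_cases hy : y ∈ tsupport k
  · have hyU := hU.mem_nhds (hkU hy)
    have h1 : ContDiffAt ℝ ∞ (fun y => flatMap (w y)) y :=
      contDiff_flatMap.contDiffAt.comp y (hw.contDiffAt hyU)
    exact ((hinv y (hkU hy)).contDiffAt_map_inverse.comp y h1).clm_apply
      (hk.fderiv_right (m := ∞) (by simp)).contDiffAt
  · refine contDiffAt_const (c := (0 : E)) |>.congr_of_eventuallyEq ?_
    filter_upwards [(isClosed_tsupport k).isOpen_compl.mem_nhds hy] with z hz
    by_contra h
    exact hz (tsupport_hamVectorField_subset w k (subset_tsupport _ h))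

end HamiltonianVectorField

/-! ### Transporting functions and flows from a chart to the manifold. -/

section ChartFlow

open Set Filter Topology

universe u

variable {E : Type u} [NormedAddCommGroup E] [NormedSpace ℝ E]
  {X : Type*} [TopologicalSpace X] [ChartedSpace E X]

open Classical in
/-- The extension by the identity of a flow supported in the chart at `c`. -/
def chartFlow (c : X) (φ : ℝ → E → E) (z : ℝ × X) : X :=
  if z.2 ∈ (extChartAt 𝓘(ℝ, E) c).source then
    (extChartAt 𝓘(ℝ, E) c).symm (φ z.1 (extChartAt 𝓘(ℝ, E) c z.2)) else z.2

open Classical in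
/-- The extension by zero of a function supported in the chart at `c`. -/
def chartFunction (c : X) (k : E → ℝ) (q : X) : ℝ :=
  if q ∈ (extChartAt 𝓘(ℝ, E) c).source then k (extChartAt 𝓘(ℝ, E) c q) else 0

theorem chartFunction_of_mem {c : X} {k : E → ℝ} {q : X}
    (hq : q ∈ (extChartAt 𝓘(ℝ, E) c).source) :
    chartFunction c k q = k (extChartAt 𝓘(ℝ, E) c q) := if_pos hq

theorem chartFunction_of_notMem {c : X} {k : E → ℝ} {q : X}
    (hq : q ∉ (extChartAt 𝓘(ℝ, E) c).source) : chartFunction c k q = 0 := if_neg hq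

theorem chartFlow_of_mem {c : X} {φ : ℝ → E → E} {t : ℝ} {q : X}
    (hq : q ∈ (extChartAt 𝓘(ℝ, E) c).source) :
    chartFlow c φ (t, q) = (extChartAt 𝓘(ℝ, E) c).symm (φ t (extChartAt 𝓘(ℝ, E) c q)) := if_pos hq

theorem chartFlow_of_notMem {c : X} {φ : ℝ → E → E} {t : ℝ} {q : X}
    (hq : q ∉ (extChartAt 𝓘(ℝ, E) c).source) : chartFlow c φ (t, q) = q := if_neg hq

/-- In a Hausdorff space the compact image is closed. Its open complement is where the extended
functions are zero and the extended flows are the identity, which gives smoothness across the edge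
of the chart. -/
theorem isClosed_symm_image [T2Space X] (c : X) {K : Set E} (hK : IsCompact K)
    (hKt : K ⊆ (extChartAt 𝓘(ℝ, E) c).target) : IsClosed ((extChartAt 𝓘(ℝ, E) c).symm '' K) :=
  (hK.image_of_continuousOn ((continuousOn_extChartAt_symm c).mono hKt)).isClosed

theorem notMem_of_notMem_symm_image {c : X} {K : Set E} {q : X}
    (hq : q ∉ (extChartAt 𝓘(ℝ, E) c).symm '' K) (hs : q ∈ (extChartAt 𝓘(ℝ, E) c).source) :
    extChartAt 𝓘(ℝ, E) c q ∉ K :=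
  fun h => hq ⟨_, h, (extChartAt 𝓘(ℝ, E) c).left_inv hs⟩

theorem mem_source_of_mem_symm_image {c : X} {K : Set E} {q : X}
    (hKt : K ⊆ (extChartAt 𝓘(ℝ, E) c).target) (hq : q ∈ (extChartAt 𝓘(ℝ, E) c).symm '' K) :
    q ∈ (extChartAt 𝓘(ℝ, E) c).source := by
  obtain ⟨y, hy, rfl⟩ := hq
  exact (extChartAt 𝓘(ℝ, E) c).map_target (hKt hy)

theorem chartFunction_eventuallyEq_zero [T2Space X] {c : X} {k : E → ℝ} (hc : HasCompactSupport k)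
    (hkt : tsupport k ⊆ (extChartAt 𝓘(ℝ, E) c).target) {q : X}
    (hq : q ∉ (extChartAt 𝓘(ℝ, E) c).source) : chartFunction c k =ᶠ[𝓝 q] fun _ => 0 := by
  have hcl := isClosed_symm_image c hc hkt
  filter_upwards [hcl.isOpen_compl.mem_nhds fun h => hq (mem_source_of_mem_symm_image hkt h)]
    with q' hq'
  by_cases hs : q' ∈ (extChartAt 𝓘(ℝ, E) c).source
  · rw [chartFunction_of_mem hs]
    exact image_eq_zero_of_notMem_tsupport (notMem_of_notMem_symm_image hq' hs)
  · exact chartFunction_of_notMem hs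

theorem contMDiffAt_extChartAt_of_mem [IsManifold 𝓘(ℝ, E) ∞ X] {c q : X}
    (hq : q ∈ (extChartAt 𝓘(ℝ, E) c).source) :
    ContMDiffAt 𝓘(ℝ, E) 𝓘(ℝ, E) ∞ (extChartAt 𝓘(ℝ, E) c) q := by
  rw [extChartAt_source] at hq
  exact contMDiffAt_extChartAt' hq

theorem contMDiff_chartFunction [T2Space X] [IsManifold 𝓘(ℝ, E) ∞ X] {c : X} {k : E → ℝ}
    (hk : ContDiff ℝ ∞ k) (hc : HasCompactSupport k)
    (hkt : tsupport k ⊆ (extChartAt 𝓘(ℝ, E) c).target) :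
    ContMDiff 𝓘(ℝ, E) 𝓘(ℝ, ℝ) ∞ (chartFunction c k) := by
  intro q
  by_cases hq : q ∈ (extChartAt 𝓘(ℝ, E) c).source
  · refine ContMDiffAt.congr_of_eventuallyEq
      (hk.contMDiff.contMDiffAt.comp q (contMDiffAt_extChartAt_of_mem hq)) ?_
    filter_upwards [(isOpen_extChartAt_source c).mem_nhds hq] with q' hq'
    exact chartFunction_of_mem hq'
  · exact contMDiffAt_const.congr_of_eventuallyEq (chartFunction_eventuallyEq_zero hc hkt hq)

/-- A point `φ_t y` outside `K` is fixed by `φ_{-t}`, so it equals `y`. Flow lines therefore never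
leave the chart. -/
theorem flow_mem_of_mem {α : Type*} {φ : ℝ → α → α} {K U : Set α} (h0 : ∀ y, φ 0 y = y)
    (hadd : ∀ s t y, φ (s + t) y = φ s (φ t y)) (hfix : ∀ y ∉ K, ∀ t, φ t y = y) (hKU : K ⊆ U)
    (t : ℝ) {y : α} (hy : y ∈ U) : φ t y ∈ U := by
  by_cases h : φ t y ∈ K
  · exact hKU h
  · have h1 := hfix _ h (-t)
    rw [← hadd, neg_add_cancel, h0] at h1
    rwa [← h1]

variable {c : X} {φ : ℝ → E → E} {K : Set E}

theorem chartFlow_zero (h0 : ∀ y, φ 0 y = y) (q : X) : chartFlow c φ (0, q) = q := by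
  by_cases hq : q ∈ (extChartAt 𝓘(ℝ, E) c).source
  · rw [chartFlow_of_mem hq, h0, (extChartAt 𝓘(ℝ, E) c).left_inv hq]
  · exact chartFlow_of_notMem hq

theorem chartFlow_add (h0 : ∀ y, φ 0 y = y)
    (hadd : ∀ s t y, φ (s + t) y = φ s (φ t y)) (hfix : ∀ y ∉ K, ∀ t, φ t y = y)
    (hKt : K ⊆ (extChartAt 𝓘(ℝ, E) c).target) (s t : ℝ) (q : X) :
    chartFlow c φ (s + t, q) = chartFlow c φ (s, chartFlow c φ (t, q)) := by
  by_cases hq : q ∈ (extChartAt 𝓘(ℝ, E) c).source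
  · have h1 := flow_mem_of_mem h0 hadd hfix hKt t ((extChartAt 𝓘(ℝ, E) c).map_source hq)
    rw [chartFlow_of_mem hq, chartFlow_of_mem hq,
      chartFlow_of_mem ((extChartAt 𝓘(ℝ, E) c).map_target h1),
      (extChartAt 𝓘(ℝ, E) c).right_inv h1, hadd]
  · rw [chartFlow_of_notMem hq, chartFlow_of_notMem hq, chartFlow_of_notMem hq]

theorem contMDiff_chartFlow [T2Space X] [IsManifold 𝓘(ℝ, E) ∞ X]
    (hφ : ContDiff ℝ ∞ (Function.uncurry φ)) (h0 : ∀ y, φ 0 y = y)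
    (hadd : ∀ s t y, φ (s + t) y = φ s (φ t y)) (hfix : ∀ y ∉ K, ∀ t, φ t y = y)
    (hK : IsCompact K) (hKt : K ⊆ (extChartAt 𝓘(ℝ, E) c).target) :
    ContMDiff (𝓘(ℝ, ℝ).prod 𝓘(ℝ, E)) 𝓘(ℝ, E) ∞ (chartFlow c φ) := by
  rintro ⟨t, q⟩
  by_cases hq : q ∈ (extChartAt 𝓘(ℝ, E) c).source
  · have h1 := flow_mem_of_mem h0 hadd hfix hKt t ((extChartAt 𝓘(ℝ, E) c).map_source hq)
    have h2 : ContMDiffAt (𝓘(ℝ, ℝ).prod 𝓘(ℝ, E)) 𝓘(ℝ, ℝ × E) ∞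
        (fun z : ℝ × X => (z.1, extChartAt 𝓘(ℝ, E) c z.2)) (t, q) :=
      contMDiffAt_fst.prodMk_space
        ((contMDiffAt_extChartAt_of_mem hq).comp (t, q) contMDiffAt_snd)
    have h3 : ContMDiffAt (𝓘(ℝ, ℝ).prod 𝓘(ℝ, E)) 𝓘(ℝ, E) ∞
        (fun z : ℝ × X => φ z.1 (extChartAt 𝓘(ℝ, E) c z.2)) (t, q) :=
      hφ.contMDiff.contMDiffAt.comp (t, q) h2
    have h4 : ContMDiffAt 𝓘(ℝ, E) 𝓘(ℝ, E) ∞ (extChartAt 𝓘(ℝ, E) c).symm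
        (φ t (extChartAt 𝓘(ℝ, E) c q)) :=
      (contMDiffOn_extChartAt_symm c).contMDiffAt ((isOpen_extChartAt_target c).mem_nhds h1)
    refine (ContMDiffAt.comp (t, q) h4 h3).congr_of_eventuallyEq ?_
    filter_upwards [(continuous_snd.isOpen_preimage _ (isOpen_extChartAt_source c)).mem_nhds
      (show (t, q) ∈ Prod.snd ⁻¹' (extChartAt 𝓘(ℝ, E) c).source from hq)] with z hz
    exact chartFlow_of_mem hz
  · refine contMDiffAt_snd.congr_of_eventuallyEq ?_
    have hcl := (isClosed_symm_image c hK hKt).isOpen_compl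
    filter_upwards [(continuous_snd.isOpen_preimage _ hcl).mem_nhds
      (show (t, q) ∈ Prod.snd ⁻¹' ((extChartAt 𝓘(ℝ, E) c).symm '' K)ᶜ from
        fun h => hq (mem_source_of_mem_symm_image hKt h))] with z hz
    by_cases hs : z.2 ∈ (extChartAt 𝓘(ℝ, E) c).source
    · rw [chartFlow_of_mem (t := z.1) hs, hfix _ (notMem_of_notMem_symm_image hz hs),
        (extChartAt 𝓘(ℝ, E) c).left_inv hs]
    · exact chartFlow_of_notMem hs

theorem mfderiv_chartFunction_symm [T2Space X] [IsManifold 𝓘(ℝ, E) ∞ X] {k : E → ℝ}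
    (hk : ContDiff ℝ ∞ k) (hc : HasCompactSupport k)
    (hkt : tsupport k ⊆ (extChartAt 𝓘(ℝ, E) c).target) {y : E}
    (hy : y ∈ (extChartAt 𝓘(ℝ, E) c).target) (w : E) :
    mfderiv 𝓘(ℝ, E) 𝓘(ℝ, ℝ) (chartFunction c k) ((extChartAt 𝓘(ℝ, E) c).symm y)
      (mfderiv 𝓘(ℝ, E) 𝓘(ℝ, E) (extChartAt 𝓘(ℝ, E) c).symm y w) = fderiv ℝ k y w := by
  have h3 : chartFunction c k ∘ (extChartAt 𝓘(ℝ, E) c).symm =ᶠ[𝓝 y] k := by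
    filter_upwards [(isOpen_extChartAt_target c).mem_nhds hy] with y' hy'
    rw [Function.comp_apply, chartFunction_of_mem ((extChartAt 𝓘(ℝ, E) c).map_target hy'),
      (extChartAt 𝓘(ℝ, E) c).right_inv hy']
  have h4 := mfderiv_comp (I' := 𝓘(ℝ, E)) (I'' := 𝓘(ℝ, ℝ)) y
    ((contMDiff_chartFunction hk hc hkt).mdifferentiable (by simp) _)
    (mdifferentiableAt_extChartAt_symm_of_mem hy)
  rw [mfderiv_eq_fderiv, h3.fderiv_eq] at h4
  exact (DFunLike.congr_fun h4 w).symm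

theorem isInvertible_mfderiv_extChartAt_symm [IsManifold 𝓘(ℝ, E) ∞ X] {y : E}
    (hy : y ∈ (extChartAt 𝓘(ℝ, E) c).target) :
    (mfderiv 𝓘(ℝ, E) 𝓘(ℝ, E) (extChartAt 𝓘(ℝ, E) c).symm y).IsInvertible := by
  have : IsManifold 𝓘(ℝ, E) 1 X := IsManifold.of_le (n := ∞) (by norm_cast)
  have h := isInvertible_mfderivWithin_extChartAt_symm (I := 𝓘(ℝ, E)) (x := c) hy
  rwa [ModelWithCorners.range_eq_univ, mfderivWithin_univ] at h

theorem flatMap_chartForm_isInvertible [FiniteDimensional ℝ E] [IsManifold 𝓘(ℝ, E) ∞ X]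
    {σ : Form E X 2} (hσ : IsSymplectic σ) {y : E} (hy : y ∈ (extChartAt 𝓘(ℝ, E) c).target) :
    (flatMap (chartForm σ c y)).IsInvertible := by
  have hinv := isInvertible_mfderiv_extChartAt_symm hy
  refine flatMap_isInvertible fun v hv => ?_
  refine (injective_iff_map_eq_zero _).1 hinv.injective v ?_
  refine hσ.nondegenerate _ _ fun w => ?_
  obtain ⟨w', rfl⟩ := hinv.surjective w
  refine Eq.trans (congrArg (σ ((extChartAt 𝓘(ℝ, E) c).symm y)) ?_) (hv w')
  ext i
  fin_cases i <;> rfl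

theorem solvesHamilton_chartFlow [FiniteDimensional ℝ E] [T2Space X] [IsManifold 𝓘(ℝ, E) ∞ X]
    {σ : Form E X 2} (hσ : IsSymplectic σ) {k : E → ℝ} (hk : ContDiff ℝ ∞ k)
    (hc : HasCompactSupport k) (hkt : tsupport k ⊆ (extChartAt 𝓘(ℝ, E) c).target)
    (h0 : ∀ y, φ 0 y = y) (hadd : ∀ s t y, φ (s + t) y = φ s (φ t y))
    (hfix : ∀ y ∉ tsupport k, ∀ t, φ t y = y)
    (hd : ∀ t y, HasDerivAt (fun t => φ t y) (hamVectorField (chartForm σ c) k (φ t y)) t) :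
    SolvesHamilton σ (chartFunction c k) (chartFlow c φ) := by
  intro t q w
  by_cases hq : q ∈ (extChartAt 𝓘(ℝ, E) c).source
  · have h1 := flow_mem_of_mem h0 hadd hfix hkt t ((extChartAt 𝓘(ℝ, E) c).map_source hq)
    set y := φ t (extChartAt 𝓘(ℝ, E) c q) with hy
    have hsymm := mdifferentiableAt_extChartAt_symm_of_mem h1
    have hder := hd t (extChartAt 𝓘(ℝ, E) c q)
    obtain ⟨Vy, hVy⟩ : ∃ v : E, v = hamVectorField (chartForm σ c) k y := ⟨_, rfl⟩
    have hcurve : (mfderiv 𝓘(ℝ, ℝ) 𝓘(ℝ, E) (fun r : ℝ => chartFlow c φ (r, q)) t (1 : ℝ) : E) =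
        mfderiv 𝓘(ℝ, E) 𝓘(ℝ, E) (extChartAt 𝓘(ℝ, E) c).symm y Vy := by
      have h2 : (fun r : ℝ => chartFlow c φ (r, q)) =
          (extChartAt 𝓘(ℝ, E) c).symm ∘ fun r => φ r (extChartAt 𝓘(ℝ, E) c q) :=
        funext fun r => chartFlow_of_mem hq
      have h3 := mfderiv_comp (I := 𝓘(ℝ, ℝ)) (I' := 𝓘(ℝ, E)) t hsymm
        hder.differentiableAt.mdifferentiableAt
      rw [mfderiv_eq_fderiv] at h3
      rw [h2]
      refine (DFunLike.congr_fun h3 (1 : ℝ)).trans ?_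
      refine congrArg (mfderiv 𝓘(ℝ, E) 𝓘(ℝ, E) (extChartAt 𝓘(ℝ, E) c).symm y) ?_
      have := hder.deriv
      rw [← fderiv_apply_one_eq_deriv] at this
      exact this.trans hVy.symm
    have hpt : chartFlow c φ (t, q) = (extChartAt 𝓘(ℝ, E) c).symm y := chartFlow_of_mem hq
    -- Tangent spaces at equal points are different types; a variable base point and vectors in the
    -- model space `E` allow substitution.
    have key : ∀ (p : X) (v w : E), p = (extChartAt 𝓘(ℝ, E) c).symm y →
        v = mfderiv 𝓘(ℝ, E) 𝓘(ℝ, E) (extChartAt 𝓘(ℝ, E) c).symm y Vy →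
        (σ p : E [⋀^Fin 2]→L[ℝ] ℝ) ![v, w] =
          (mfderiv 𝓘(ℝ, E) 𝓘(ℝ, ℝ) (chartFunction c k) p : E →L[ℝ] ℝ) w := by
      rintro p v w rfl rfl
      obtain ⟨w', rfl⟩ := (isInvertible_mfderiv_extChartAt_symm h1).surjective w
      have h2 := apply_hamVectorField (k := k) (flatMap_chartForm_isInvertible hσ h1) w'
      rw [← hVy] at h2
      refine Eq.trans ?_ (h2.trans (mfderiv_chartFunction_symm hk hc hkt h1 w').symm)
      refine congrArg (σ ((extChartAt 𝓘(ℝ, E) c).symm y)) ?_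
      ext i
      fin_cases i <;> rfl
    exact key _ _ w hpt hcurve
  · have h2 : (fun r : ℝ => chartFlow c φ (r, q)) = fun _ => q :=
      funext fun r => chartFlow_of_notMem hq
    have h3 := (chartFunction_eventuallyEq_zero hc hkt hq).mfderiv_eq (I := 𝓘(ℝ, E))
      (I' := 𝓘(ℝ, ℝ))
    rw [mfderiv_const] at h3
    have key : ∀ (p : X) (v w : E), p = q → v = 0 →
        (σ p : E [⋀^Fin 2]→L[ℝ] ℝ) ![v, w] =
          (mfderiv 𝓘(ℝ, E) 𝓘(ℝ, ℝ) (chartFunction c k) p : E →L[ℝ] ℝ) w := by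
      rintro p v w' rfl rfl
      refine Eq.trans (ContinuousAlternatingMap.map_coord_zero (f := σ p) 0 rfl) ?_
      exact (DFunLike.congr_fun h3 w').symm
    refine key _ _ w (chartFlow_of_notMem hq) ?_
    rw [h2, mfderiv_const]
    rfl

/-- A compactly supported function in a chart of a symplectic manifold generates a global
Hamiltonian flow. -/
theorem exists_hamiltonian_flow [FiniteDimensional ℝ E] [T2Space X] [IsManifold 𝓘(ℝ, E) ∞ X]
    {σ : Form E X 2} (hσ : IsSymplectic σ) (c : X) {k : E → ℝ} (hk : ContDiff ℝ ∞ k)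
    (hc : HasCompactSupport k) (hkt : tsupport k ⊆ (extChartAt 𝓘(ℝ, E) c).target) :
    ∃ Φ : ℝ × X → X, ContMDiff (𝓘(ℝ, ℝ).prod 𝓘(ℝ, E)) 𝓘(ℝ, E) ∞ Φ ∧ (∀ q, Φ (0, q) = q) ∧
      (∀ s t q, Φ (s + t, q) = Φ (s, Φ (t, q))) ∧ SolvesHamilton σ (chartFunction c k) Φ ∧
      ∀ q, (q ∈ (extChartAt 𝓘(ℝ, E) c).source →
        fderiv ℝ k (extChartAt 𝓘(ℝ, E) c q) = 0) → ∀ t, Φ (t, q) = q := by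
  have : CompleteSpace E := FiniteDimensional.complete ℝ E
  have hsub := tsupport_hamVectorField_subset (chartForm σ c) k
  have hV := contDiff_hamVectorField (isOpen_extChartAt_target c) (hσ.smooth c)
    (fun y hy => flatMap_chartForm_isInvertible hσ hy) hk hkt
  obtain ⟨φ, hφ, h0, hadd, hd, hzero⟩ := exists_contDiff_flow hV
    (hc.of_isClosed_subset (isClosed_tsupport _) hsub)
  have hfix : ∀ y ∉ tsupport k, ∀ t, φ t y = y := fun y hy =>
    hzero y (image_eq_zero_of_notMem_tsupport fun h => hy (hsub h))
  refine ⟨chartFlow c φ, contMDiff_chartFlow hφ h0 hadd hfix hc hkt, chartFlow_zero h0,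
    chartFlow_add h0 hadd hfix hkt, solvesHamilton_chartFlow hσ hk hc hkt h0 hadd hfix hd,
    fun q hq t => ?_⟩
  by_cases hs : q ∈ (extChartAt 𝓘(ℝ, E) c).source
  · rw [chartFlow_of_mem hs, hzero _ (hamVectorField_eq_zero _ (hq hs)),
      (extChartAt 𝓘(ℝ, E) c).left_inv hs]
  · exact chartFlow_of_notMem hs

end ChartFlow

/-! ### Flows, their reparametrisations and their lifts to coverings. -/

section Lift

open Set Filter Topology

variable {E : Type*} [NormedAddCommGroup E] [NormedSpace ℝ E]
  {M : Type*} [TopologicalSpace M] [ChartedSpace E M]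
  {X : Type*} [TopologicalSpace X] [ChartedSpace E X]

/-- A smooth action of the real line by maps, i.e. a global flow. -/
structure IsFlow (Φ : ℝ × X → X) : Prop where
  smooth : ContMDiff (𝓘(ℝ, ℝ).prod 𝓘(ℝ, E)) 𝓘(ℝ, E) ∞ Φ
  zero : ∀ q, Φ (0, q) = q
  add : ∀ s t q, Φ (s + t, q) = Φ (s, Φ (t, q))

variable {Φ : ℝ × X → X}

theorem IsFlow.contMDiff_time (hΦ : IsFlow (E := E) Φ) (t : ℝ) :
    ContMDiff 𝓘(ℝ, E) 𝓘(ℝ, E) ∞ fun q => Φ (t, q) :=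
  hΦ.smooth.comp (contMDiff_const.prodMk contMDiff_id)

theorem IsFlow.contMDiff_orbit (hΦ : IsFlow (E := E) Φ) (q : X) :
    ContMDiff 𝓘(ℝ, ℝ) 𝓘(ℝ, E) ∞ fun t => Φ (t, q) :=
  hΦ.smooth.comp (contMDiff_id.prodMk contMDiff_const)

/-- The diffeomorphisms that make up a flow. -/
def IsFlow.diffeo (hΦ : IsFlow (E := E) Φ) (t : ℝ) : X ≃ₘ⟮𝓘(ℝ, E), 𝓘(ℝ, E)⟯ X where
  toFun q := Φ (t, q)
  invFun q := Φ (-t, q)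
  left_inv q := by beta_reduce; rw [← hΦ.add, neg_add_cancel, hΦ.zero]
  right_inv q := by beta_reduce; rw [← hΦ.add, add_neg_cancel, hΦ.zero]
  contMDiff_toFun := hΦ.contMDiff_time t
  contMDiff_invFun := hΦ.contMDiff_time (-t)

@[simp]
theorem IsFlow.diffeo_apply (hΦ : IsFlow (E := E) Φ) (t : ℝ) (q : X) :
    hΦ.diffeo t q = Φ (t, q) := rfl

theorem IsFlow.isIsotopy (hΦ : IsFlow (E := E) Φ) (r : ℝ) :
    IsIsotopy fun t => hΦ.diffeo (r * t) where
  smooth := by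
    have h : ContMDiff (𝓘(ℝ, ℝ).prod 𝓘(ℝ, E)) (𝓘(ℝ, ℝ).prod 𝓘(ℝ, E)) ∞
        (fun z : ℝ × X => (r * z.1, z.2)) :=
      ((contDiff_const.mul contDiff_id).contMDiff.comp contMDiff_fst).prodMk contMDiff_snd
    exact hΦ.smooth.comp h
  start q := by simp [hΦ.zero]

/-- Speeding up the Hamiltonian flow of `H` by the factor `r` gives the Hamiltonian flow of
`r * H`. -/
theorem IsFlow.isHamiltonianIsotopy (hΦ : IsFlow (E := E) Φ) {σ : Form E X 2} {H : X → ℝ}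
    (hH : ContMDiff 𝓘(ℝ, E) 𝓘(ℝ, ℝ) ∞ H) (hham : SolvesHamilton σ H Φ) (r : ℝ) :
    IsHamiltonianIsotopy σ (fun _ q => r * H q) fun t => hΦ.diffeo (r * t) where
  toIsIsotopy := hΦ.isIsotopy r
  smooth_hamiltonian := contMDiff_const.mul (hH.comp contMDiff_snd)
  equation := by
    intro t q w
    have h1 : HasDerivAt (fun t : ℝ => r * t) r t := by simpa using (hasDerivAt_id t).const_mul r
    have h2 := mfderiv_comp (I := 𝓘(ℝ, ℝ)) (I' := 𝓘(ℝ, ℝ)) t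
      ((hΦ.contMDiff_orbit q).mdifferentiable (by simp) (r * t))
      h1.differentiableAt.mdifferentiableAt
    rw [mfderiv_eq_fderiv] at h2
    have h3 : (mfderiv 𝓘(ℝ, ℝ) 𝓘(ℝ, E) (fun s : ℝ => hΦ.diffeo (r * s) q) t (1 : ℝ) : E) =
        r • (mfderiv 𝓘(ℝ, ℝ) 𝓘(ℝ, E) (fun s : ℝ => Φ (s, q)) (r * t) (1 : ℝ) : E) := by
      refine (DFunLike.congr_fun h2 (1 : ℝ)).trans ?_
      have h4 : (fderiv ℝ (fun t : ℝ => r * t) t (1 : ℝ) : ℝ) = r • (1 : ℝ) := by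
        rw [fderiv_apply_one_eq_deriv, h1.deriv, smul_eq_mul, mul_one]
      refine (congrArg (mfderiv 𝓘(ℝ, ℝ) 𝓘(ℝ, E) (fun s : ℝ => Φ (s, q)) (r * t)) h4).trans ?_
      exact map_smul _ _ _
    have h5 : mfderiv 𝓘(ℝ, E) 𝓘(ℝ, ℝ) (fun q => r * H q) (Φ (r * t, q)) =
        r • mfderiv 𝓘(ℝ, E) 𝓘(ℝ, ℝ) H (Φ (r * t, q)) :=
      const_smul_mfderiv (hH.mdifferentiable (by simp) _) r
    have key : ∀ (A : E [⋀^Fin 2]→L[ℝ] ℝ) (B B' : E →L[ℝ] ℝ) (v v' w : E),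
        A ![v, w] = B w → v' = r • v → B' = r • B → A ![v', w] = B' w := by
      rintro A B _ v _ w h rfl rfl
      have := (flatMap A).map_smul r v
      rw [← flatMap_apply, this]
      simp [h]
    exact key _ _ _ _ _ w (hham (r * t) q w) h3 h5

/-- A flow on the base of a smooth covering map lifts to the total space. -/
theorem IsFlow.exists_lift (hΦ : IsFlow (E := E) Φ) {p : M → X} (hp : IsCoveringMap p)
    (hpd : IsLocalDiffeomorph 𝓘(ℝ, E) 𝓘(ℝ, E) ∞ p) :
    ∃ Ψ : ℝ × M → M, IsFlow (E := E) Ψ ∧ (∀ t y, p (Ψ (t, y)) = Φ (t, p y)) ∧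
      ∀ y, (∀ t, Φ (t, p y) = p y) → ∀ t, Ψ (t, y) = y := by
  have hpc : Continuous p := hp.continuous
  have hΦc : Continuous Φ := hΦ.smooth.continuous
  -- The homotopy `r ↦ Φ(r t, p y)`, with parameter `(t, y)`, starts at `p y`. Its lift starting at
  -- `y`, evaluated at `r = 1`, is the lifted flow. Fixed points and the group law follow from
  -- uniqueness of lifts.
  let H : C(unitInterval × (ℝ × M), X) :=
    ⟨fun z => Φ (z.1 * z.2.1, p z.2.2), hΦc.comp (by fun_prop)⟩
  let f : C(ℝ × M, M) := ⟨Prod.snd, continuous_snd⟩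
  have H0 : ∀ a, H (0, a) = p (f a) := fun a => by simp [H, f, hΦ.zero]
  let L := hp.liftHomotopy H f H0
  have hL : ∀ r a, p (L (r, a)) = Φ (r * a.1, p a.2) := fun r a =>
    congrFun (hp.liftHomotopy_lifts H f H0) (r, a)
  let Ψ : ℝ × M → M := fun a => L (1, a)
  have hΨc : Continuous Ψ := L.continuous.comp (by fun_prop)
  have hΨp : ∀ t y, p (Ψ (t, y)) = Φ (t, p y) := fun t y => by simp [Ψ, hL]
  have hΨ0 : ∀ y, Ψ (0, y) = y := by
    intro y
    have h1 : (fun r : unitInterval => L (r, (0, y))) = fun _ => y := by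
      refine hp.eq_of_comp_eq (L.continuous.comp (by fun_prop)) continuous_const ?_ 0
        (hp.liftHomotopy_zero H f H0 (0, y))
      funext r
      simp [hL, hΦ.zero]
    exact congrFun h1 1
  have hΨorb : ∀ y, Continuous fun t => Ψ (t, y) := fun y => hΨc.comp (by fun_prop)
  have hΨfix : ∀ y, (∀ t, Φ (t, p y) = p y) → ∀ t, Ψ (t, y) = y := by
    intro y hy
    refine congrFun (hp.eq_of_comp_eq (hΨorb y) continuous_const ?_ 0 (hΨ0 y))
    funext t
    simp [hΨp, hy]
  have hΨadd : ∀ s t y, Ψ (s + t, y) = Ψ (s, Ψ (t, y)) := by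
    intro s t y
    refine congrFun (hp.eq_of_comp_eq (g₁ := fun s => Ψ (s + t, y))
      (g₂ := fun s => Ψ (s, Ψ (t, y))) ((hΨorb y).comp (by fun_prop)) (hΨorb _) ?_ 0 ?_) s
    · funext s
      simp [hΨp, hΦ.add]
    · simp [hΨ0]
  refine ⟨Ψ, ⟨fun z => ?_, hΨ0, hΨadd⟩, hΨp, hΨfix⟩
  -- Locally `Ψ` is a smooth local inverse of `p` applied to the smooth map `p ∘ Ψ`; continuity of
  -- `Ψ` keeps the values on the right sheet.
  have hloc := hpd (Ψ z)
  have hcomp : ContMDiffAt (𝓘(ℝ, ℝ).prod 𝓘(ℝ, E)) 𝓘(ℝ, E) ∞ (fun z => p (Ψ z)) z := by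
    have h1 : ContMDiff (𝓘(ℝ, ℝ).prod 𝓘(ℝ, E)) (𝓘(ℝ, ℝ).prod 𝓘(ℝ, E)) ∞
        (fun z : ℝ × M => (z.1, p z.2)) :=
      contMDiff_fst.prodMk (hpd.contMDiff.comp contMDiff_snd)
    have h2 : (fun z => p (Ψ z)) = fun z : ℝ × M => Φ (z.1, p z.2) :=
      funext fun z => hΨp z.1 z.2
    rw [h2]
    exact (hΦ.smooth.comp h1) z
  refine (ContMDiffAt.comp z hloc.localInverse_contMDiffAt hcomp).congr_of_eventuallyEq ?_
  filter_upwards [hΨc.continuousAt.eventually hloc.localInverse_eventuallyEq_left] with z' hz'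
  exact hz'.symm

/-- Lifts of Hamiltonian flows are Hamiltonian flows. -/
theorem SolvesHamilton.lift {σ : Form E X 2} {H : X → ℝ} (hham : SolvesHamilton σ H Φ)
    (hH : ContMDiff 𝓘(ℝ, E) 𝓘(ℝ, ℝ) ∞ H) {p : M → X}
    (hp : ContMDiff 𝓘(ℝ, E) 𝓘(ℝ, E) ∞ p) {Ψ : ℝ × M → M} (hΨ : IsFlow (E := E) Ψ)
    (hlift : ∀ t y, p (Ψ (t, y)) = Φ (t, p y)) :
    SolvesHamilton (pullback (E := E) p σ) (H ∘ p) Ψ := by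
  intro s y w
  have h1 : (fun r => Φ (r, p y)) = p ∘ fun r => Ψ (r, y) := funext fun r => (hlift r y).symm
  have h2 := mfderiv_comp (I := 𝓘(ℝ, ℝ)) (I' := 𝓘(ℝ, E)) s
    (hp.mdifferentiable (by simp) (Ψ (s, y)))
    ((hΨ.contMDiff_orbit y).mdifferentiable (by simp) s)
  have h3 := mfderiv_comp (I' := 𝓘(ℝ, E)) (I'' := 𝓘(ℝ, ℝ)) (Ψ (s, y))
    (hH.mdifferentiable (by simp) _) (hp.mdifferentiable (by simp) _)
  have key : ∀ (a b : X) (v v' w : E), a = b → v = v' →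
      (σ b : E [⋀^Fin 2]→L[ℝ] ℝ) ![v', w] = (mfderiv 𝓘(ℝ, E) 𝓘(ℝ, ℝ) H b : E →L[ℝ] ℝ) w →
      (σ a : E [⋀^Fin 2]→L[ℝ] ℝ) ![v, w] = (mfderiv 𝓘(ℝ, E) 𝓘(ℝ, ℝ) H a : E →L[ℝ] ℝ) w := by
    rintro a b v v' w rfl rfl h
    exact h
  have h4 : (mfderiv 𝓘(ℝ, ℝ) 𝓘(ℝ, E) (fun r => Φ (r, p y)) s (1 : ℝ) : E) =
      mfderiv 𝓘(ℝ, E) 𝓘(ℝ, E) p (Ψ (s, y))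
        (mfderiv 𝓘(ℝ, ℝ) 𝓘(ℝ, E) (fun r => Ψ (r, y)) s (1 : ℝ)) := by
    rw [h1]
    exact DFunLike.congr_fun h2 (1 : ℝ)
  have h5 := key (p (Ψ (s, y))) (Φ (s, p y)) _ _ (mfderiv 𝓘(ℝ, E) 𝓘(ℝ, E) p (Ψ (s, y)) w)
    (hlift s y) h4.symm (hham s (p y) _)
  refine Eq.trans ?_ (h5.trans (DFunLike.congr_fun h3 w).symm)
  refine congrArg (σ (p (Ψ (s, y)))) ?_
  ext i
  fin_cases i <;> rfl

end Lift

/-! ### Choice of the two Hamiltonians and unboundedness. -/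

section Unbounded

open Set Filter Topology

variable {E : Type*} [NormedAddCommGroup E] [NormedSpace ℝ E]
  {M : Type*} [TopologicalSpace M] [ChartedSpace E M]
  {X : Type*} [TopologicalSpace X] [ChartedSpace E X]

/-- The time-`r` map of a lifted Hamiltonian flow, as a symplectic diffeomorphism. -/
def IsFlow.symp [IsManifold 𝓘(ℝ, E) ∞ M] {Ψ : ℝ × M → M} (hΨ : IsFlow (E := E) Ψ)
    {η : Form E M 2} (hη : IsSymplectic η) {H : M → ℝ} (hH : ContMDiff 𝓘(ℝ, E) 𝓘(ℝ, ℝ) ∞ H)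
    (hham : SolvesHamilton η H Ψ) (r : ℝ) : Symp η :=
  ⟨hΨ.diffeo r, pullback_flow_eq hη.smooth hη.closed hΨ.smooth hH hham hΨ.zero r⟩

/-- The time-`r` map is the time-one map of the flow run at speed `r`, generated by `r H`, and the
lifted flow at the same speed covers it. -/
theorem IsFlow.symp_mem_hamInSymp [IsManifold 𝓘(ℝ, E) ∞ M] {Ψ : ℝ × M → M}
    (hΨ : IsFlow (E := E) Ψ) {η : Form E M 2} (hη : IsSymplectic η) {H' : M → ℝ}
    (hH' : ContMDiff 𝓘(ℝ, E) 𝓘(ℝ, ℝ) ∞ H') (hham' : SolvesHamilton η H' Ψ)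
    {σ : Form E X 2} {p : M → X} {Φ : ℝ × X → X} (hΦ : IsFlow (E := E) Φ) {H : X → ℝ}
    (hH : ContMDiff 𝓘(ℝ, E) 𝓘(ℝ, ℝ) ∞ H) (hham : SolvesHamilton σ H Φ)
    (hlift : ∀ t y, p (Ψ (t, y)) = Φ (t, p y)) (r : ℝ) :
    hΨ.symp hη hH' hham' r ∈ hamInSymp η σ p := by
  have h1 := hΦ.isHamiltonianIsotopy hH hham r
  refine ⟨hΦ.diffeo r, ⟨_, _, h1, by rw [mul_one]⟩, _, _, _, h1, by rw [mul_one],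
    hΨ.isIsotopy r, fun t y => hlift _ y, ?_⟩
  rw [mul_one]
  rfl

/-- Near any point of a positive-dimensional symplectic manifold there is a compactly supported
Hamiltonian whose flow moves that point. -/
theorem exists_hamiltonian_flow_moving [FiniteDimensional ℝ E] (hdim : 0 < Module.finrank ℝ E)
    [T2Space X] [IsManifold 𝓘(ℝ, E) ∞ X] {σ : Form E X 2} (hσ : IsSymplectic σ) (q : X) :
    ∃ (H : X → ℝ) (Φ : ℝ × X → X), ContMDiff 𝓘(ℝ, E) 𝓘(ℝ, ℝ) ∞ H ∧ IsFlow (E := E) Φ ∧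
      SolvesHamilton σ H Φ ∧ ∃ s, Φ (s, q) ≠ q := by
  have hqt := mem_extChartAt_target (I := 𝓘(ℝ, E)) q
  set y := extChartAt 𝓘(ℝ, E) q q
  obtain ⟨ε, hε, hball⟩ := Metric.nhds_basis_closedBall.mem_iff.1
    ((isOpen_extChartAt_target (I := 𝓘(ℝ, E)) q).mem_nhds hqt)
  let b : ContDiffBump y := ⟨ε / 2, ε, half_pos hε, half_lt_self hε⟩
  have : Nontrivial E := Module.nontrivial_of_finrank_pos hdim
  obtain ⟨v, hv⟩ := exists_ne (0 : E)
  obtain ⟨l, hl⟩ := SeparatingDual.exists_ne_zero (R := ℝ) hv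
  -- Near `y` this function is the linear form `l`, so its differential there is nonzero. If `q`
  -- were stationary, Hamilton's equation would force that differential to vanish.
  let k : E → ℝ := fun y => b y * l y
  have hk : ContDiff ℝ ∞ k := b.contDiff.mul l.contDiff
  have hkb : tsupport k ⊆ Metric.closedBall y ε := (tsupport_mul_subset_left).trans b.tsupport_eq.le
  have hc : HasCompactSupport k := b.hasCompactSupport.mul_right
  have hkd : fderiv ℝ k y v = l v := by
    have : k =ᶠ[𝓝 y] l := by
      filter_upwards [b.eventuallyEq_one] with z hz
      simp only [k, hz, Pi.one_apply, one_mul]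
    rw [this.fderiv_eq, l.fderiv]
  obtain ⟨Φ, hs, h0, hadd, hham, -⟩ := exists_hamiltonian_flow hσ q hk hc (hkb.trans hball)
  refine ⟨chartFunction q k, Φ, contMDiff_chartFunction hk hc (hkb.trans hball), ⟨hs, h0, hadd⟩,
    hham, ?_⟩
  by_contra! hcon
  have hconst : (fun r => Φ (r, q)) = fun _ => q := funext hcon
  have key : ∀ (a : X) (u w : E), a = (extChartAt 𝓘(ℝ, E) q).symm y → u = 0 →
      w = mfderiv 𝓘(ℝ, E) 𝓘(ℝ, E) (extChartAt 𝓘(ℝ, E) q).symm y v →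
      (σ a : E [⋀^Fin 2]→L[ℝ] ℝ) ![u, w] =
        (mfderiv 𝓘(ℝ, E) 𝓘(ℝ, ℝ) (chartFunction q k) a : E →L[ℝ] ℝ) w → False := by
    rintro a u w rfl rfl rfl h
    have h1 := h.trans (mfderiv_chartFunction_symm hk hc (hkb.trans hball) hqt v)
    rw [hkd] at h1
    exact hl (h1.symm.trans (ContinuousAlternatingMap.map_coord_zero (f := σ _) 0 rfl))
  refine key _ _ _ ?_ ?_ rfl (hham 0 q (mfderiv 𝓘(ℝ, E) 𝓘(ℝ, E) (extChartAt 𝓘(ℝ, E) q).symm y v))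
  · rw [hcon]
    exact ((extChartAt 𝓘(ℝ, E) q).left_inv (mem_extChartAt_source q)).symm
  · rw [hconst, mfderiv_const]
    rfl

/-- There is a Hamiltonian flow that fixes two given points and whose Hamiltonian has prescribed
value at one of them and vanishes at the other. -/
theorem exists_hamiltonian_flow_fixing [FiniteDimensional ℝ E]
    [T2Space X] [IsManifold 𝓘(ℝ, E) ∞ X] {σ : Form E X 2} (hσ : IsSymplectic σ) {q q' : X}
    (hqq' : q' ≠ q) (C : ℝ) :
    ∃ (H : X → ℝ) (Φ : ℝ × X → X), ContMDiff 𝓘(ℝ, E) 𝓘(ℝ, ℝ) ∞ H ∧ IsFlow (E := E) Φ ∧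
      SolvesHamilton σ H Φ ∧ (∀ t, Φ (t, q) = q) ∧ (∀ t, Φ (t, q') = q') ∧ H q = C ∧ H q' = 0 := by
  have hqt := mem_extChartAt_target (I := 𝓘(ℝ, E)) q
  set y := extChartAt 𝓘(ℝ, E) q q with hy
  obtain ⟨ε, hε, hball⟩ := Metric.nhds_basis_closedBall.mem_iff.1
    ((isOpen_extChartAt_target (I := 𝓘(ℝ, E)) q).mem_nhds hqt)
  -- The radius is small enough for the support of the bump to lie in the chart and to miss `q'`.
  obtain ⟨r, hr, hrε, hrd⟩ : ∃ r > 0, r ≤ ε ∧ (q' ∈ (extChartAt 𝓘(ℝ, E) q).source →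
      extChartAt 𝓘(ℝ, E) q q' ∉ Metric.closedBall y r) := by
    by_cases hs : q' ∈ (extChartAt 𝓘(ℝ, E) q).source
    · have hne : extChartAt 𝓘(ℝ, E) q q' ≠ y := fun h =>
        hqq' ((extChartAt 𝓘(ℝ, E) q).injOn hs (mem_extChartAt_source q) h)
      have hd := dist_pos.2 hne
      refine ⟨min ε (dist (extChartAt 𝓘(ℝ, E) q q') y / 2), by positivity, min_le_left _ _,
        fun _ h => ?_⟩
      have := (Metric.mem_closedBall.1 h).trans (min_le_right _ _)
      linarith
    · exact ⟨ε, hε, le_rfl, fun h => absurd h hs⟩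
  let b : ContDiffBump y := ⟨r / 2, r, half_pos hr, half_lt_self hr⟩
  let k : E → ℝ := fun y => C * b y
  have hk : ContDiff ℝ ∞ k := contDiff_const.mul b.contDiff
  have hkb : tsupport k ⊆ Metric.closedBall y r := (tsupport_mul_subset_right).trans b.tsupport_eq.le
  have hkt := (hkb.trans (Metric.closedBall_subset_closedBall hrε)).trans hball
  have hc : HasCompactSupport k := b.hasCompactSupport.mul_left
  -- The bump is constant near its centre, so `q` is a critical point and is fixed by the flow
  -- although the Hamiltonian is large there.
  have hkd : fderiv ℝ k y = 0 := by
    have : k =ᶠ[𝓝 y] fun _ => C := by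
      filter_upwards [b.eventuallyEq_one] with z hz
      simp only [k, hz, Pi.one_apply, mul_one]
    rw [this.fderiv_eq, fderiv_fun_const]
    rfl
  obtain ⟨Φ, hs, h0, hadd, hham, hfix⟩ := exists_hamiltonian_flow hσ q hk hc hkt
  refine ⟨chartFunction q k, Φ, contMDiff_chartFunction hk hc hkt, ⟨hs, h0, hadd⟩, hham,
    hfix q fun _ => hkd, hfix q' fun h => ?_, ?_, ?_⟩
  · exact image_eq_zero_of_notMem_tsupport fun h' =>
      hrd h (hkb (tsupport_fderiv_subset ℝ h'))
  · rw [chartFunction_of_mem (mem_extChartAt_source q), ← hy]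
    simp only [k]
    rw [b.one_of_mem_closedBall (Metric.mem_closedBall_self (half_pos hr).le), mul_one]
  · by_cases h : q' ∈ (extChartAt 𝓘(ℝ, E) q).source
    · rw [chartFunction_of_mem h]
      exact image_eq_zero_of_notMem_tsupport fun h' => hrd h (hkb h')
    · exact chartFunction_of_notMem h

/-- The cocycle is unbounded on lifts of Hamiltonian diffeomorphisms along any smooth covering
map. -/
theorem unboundedOn_hamInSymp [FiniteDimensional ℝ E] (hdim : 0 < Module.finrank ℝ E)
    [IsManifold 𝓘(ℝ, E) ∞ M] {lam : Form E M 1} (hlam : IsSmooth lam)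
    (hsymp : IsSymplectic (extD lam)) (x : M) [T2Space X] [IsManifold 𝓘(ℝ, E) ∞ X]
    {σ : Form E X 2} (hσ : IsSymplectic σ) {p : M → X} (hp : IsCoveringMap p)
    (hpd : IsLocalDiffeomorph 𝓘(ℝ, E) 𝓘(ℝ, E) ∞ p) (hpσ : pullback (E := E) p σ = extD lam) :
    UnboundedOn (cocycle lam x) (hamInSymp (extD lam) σ p) := by
  intro C
  obtain ⟨H₁, Φ₁, hH₁, hΦ₁, hham₁, s, hs⟩ := exists_hamiltonian_flow_moving hdim hσ (p x)
  obtain ⟨H₂, Φ₂, hH₂, hΦ₂, hham₂, hfx, hfy, hHx, hHy⟩ :=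
    exists_hamiltonian_flow_fixing hσ hs (|C| + 1)
  obtain ⟨Ψ₁, hΨ₁, hl₁, -⟩ := hΦ₁.exists_lift hp hpd
  obtain ⟨Ψ₂, hΨ₂, hl₂, hf₂⟩ := hΦ₂.exists_lift hp hpd
  have hham₁' := hham₁.lift hH₁ hpd.contMDiff hΨ₁ hl₁
  have hham₂' := hham₂.lift hH₂ hpd.contMDiff hΨ₂ hl₂
  rw [hpσ] at hham₁' hham₂'
  have hH₁' := hH₁.comp hpd.contMDiff
  have hH₂' := hH₂.comp hpd.contMDiff
  refine ⟨hΨ₂.symp hsymp hH₂' hham₂' 1,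
    hΨ₂.symp_mem_hamInSymp hsymp hH₂' hham₂' hΦ₂ hH₂ hham₂ hl₂ 1,
    hΨ₁.symp hsymp hH₁' hham₁' s,
    hΨ₁.symp_mem_hamInSymp hsymp hH₁' hham₁' hΦ₁ hH₁ hham₁ hl₁ s, ?_⟩
  -- The orbit of `x` is a smooth path, so `integralBetween` is a genuine integral and not the
  -- default value `0`. The integral formula then holds for whichever path was chosen.
  have hpath : ∃ γ : ℝ → M, IsSmoothPath E γ x (Ψ₁ (s, x)) := by
    refine ⟨fun t => Ψ₁ (s * t, x), (hΨ₁.contMDiff_orbit x).comp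
      (contDiff_const.mul contDiff_id).contMDiff, ?_, ?_⟩
    · simp [hΨ₁.zero]
    · simp
  have hval : cocycle lam x (hΨ₂.symp hsymp hH₂' hham₂' 1) (hΨ₁.symp hsymp hH₁' hham₁' s) =
      (H₂ ∘ p) (Ψ₁ (s, x)) - (H₂ ∘ p) x := by
    refine (dif_pos hpath).trans ?_
    refine pathIntegral_pullback_flow_sub hlam hΨ₂.smooth hH₂' hham₂' hΨ₂.zero
      hpath.choose_spec (hf₂ x hfx) (hf₂ _ ?_)
    rw [hl₁]
    exact hfy
  rw [hval, Function.comp_apply, Function.comp_apply, hl₁, hHx, hHy, zero_sub, abs_neg,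
    abs_of_pos (by positivity)]
  exact (le_abs_self C).trans_lt (lt_add_one _)

end Unbounded

/-- The one-point fibre makes the whole space evenly covered; with this trivial covering the first
claim becomes a case of the second construction. -/
theorem isCoveringMap_id (M : Type*) [TopologicalSpace M] : IsCoveringMap (id : M → M) :=
  fun x => IsEvenlyCovered.to_isEvenlyCovered_preimage (I := PUnit.{1})
    ⟨inferInstance, Set.univ, Set.mem_univ x, isOpen_univ, isOpen_univ,
      (Homeomorph.prodPUnit _).symm, fun _ => rfl⟩

end SympCocycle

end

theorem theorem1p6
    {E : Type*} [NormedAddCommGroup E] [NormedSpace ℝ E] [FiniteDimensional ℝ E]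
    (hdim : 0 < Module.finrank ℝ E)
    {M : Type*} [TopologicalSpace M] [ChartedSpace E M] [IsManifold 𝓘(ℝ, E) ∞ M]
    [T2Space M] [SecondCountableTopology M] [ConnectedSpace M]
    (hH1 : SympCocycle.FirstCohomologyVanishes E M)
    (lam : SympCocycle.Form E M 1) (hlam : SympCocycle.IsSmooth lam)
    (hsymp : SympCocycle.IsSymplectic (SympCocycle.extD lam)) (x : M) :
    SympCocycle.UnboundedOn (SympCocycle.cocycle lam x) Set.univ ∧
    ∀ (X : Type*) [TopologicalSpace X] [ChartedSpace E X] [IsManifold 𝓘(ℝ, E) ∞ X]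
      [T2Space X] [CompactSpace X]
      (σ : SympCocycle.Form E X 2) (p : M → X),
      SympCocycle.IsSymplectic σ →
      SympCocycle.IsUniversalCover (SympCocycle.extD lam) σ p →
      SympCocycle.UnboundedOn (SympCocycle.cocycle lam x)
        (SympCocycle.hamInSymp (SympCocycle.extD lam) σ p) := by
  refine ⟨fun C => ?_, fun X _ _ _ _ _ σ p hσ hp =>
    SympCocycle.unboundedOn_hamInSymp hdim hlam hsymp x hσ hp.covering hp.localDiffeo
      hp.pullback_eq⟩
  have hid : SympCocycle.pullback (E := E) (id : M → M) (SympCocycle.extD lam) =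
      SympCocycle.extD lam := by
    funext q
    simp only [SympCocycle.pullback, mfderiv_id]
    rfl
  -- Take `X = M`, `σ = dλ` and `p = id`.
  obtain ⟨g, -, h, -, hC⟩ := SympCocycle.unboundedOn_hamInSymp hdim hlam hsymp x hsymp
    (SympCocycle.isCoveringMap_id M)
    (Diffeomorph.refl 𝓘(ℝ, E) M ∞).isLocalDiffeomorph hid C
  exact ⟨g, Set.mem_univ g, h, Set.mem_univ h, hC⟩
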